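/- **Theorem 1.1 (Regularity).** Let $m\ge 1$ be an integer and $\alpha\in\mathbb R$ with $\alpha-2m+1>0$. Put $2^*=\frac{2(\alpha+1)}{\alpha-2m+1}$, $\Delta_\alpha u=u''+\frac{\alpha}{r}u'$, and $$\nabla^m_\alpha u=\Delta_\alpha^k u \ \text{ if } m=2k,\qquad \nabla^m_\alpha u=(\Delta_\alpha^k u)' \ \text{ if } m=2k+1 .$$ Let $\mathcal D^{m,2}_\infty(\alpha)$ be the completion, under the norm $\big(\int_0^\infty|u^{(m)}|^2r^\alpha\,dr\big)^{1/2}$, of the space of functions $u:(0,\infty)\to\mathbb R$ that have derivatives up to order $m-1$, with $u^{(m-1)}$ locally absolutely continuous on $(0,\infty)$, $\lim_{r\to\infty}u^{(j)}(r)=0$ for $j=0,\dots,m-1$, and $\int_0^\infty|u^{(m)}|^2r^\alpha\,dr<\infty$. Since $\alpha-2m+1>0$, convergence in this norm implies pointwise convergence on $(0,\infty)$, and the elements of $\mathcal D^{m,2}_\infty(\alpha)$ are identified with functions on $(0,\infty)$. Let $u\in\mathcal D^{m,2}_\infty(\alpha)$ be a weak solution of $$(-\Delta_\alpha)^m u=|u|^{2^*-2}u\quad\text{in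 }(0,\infty),\tag{1}$$ that is, $$\int_0^\infty \nabla^m_\alpha u\,\nabla^m_\alpha v\,r^\alpha\,dr=\int_0^\infty|u|^{2^*-2}u\,v\,r^\alpha\,dr\qquad\text{for all }v\in\mathcal D^{m,2}_\infty(\alpha).$$ Then $u\in C^{2m}(0,\infty)$ and $u$ satisfies (1) at every $r>0$. Moreover, $$\lim_{r\to0^+}r^\alpha\Delta_\alpha^ju(r)=\lim_{r\to0^+}r^\alpha(\Delta_\alpha^ju)'(r)=0\qquad\text{for }j=0,1,\dots,m-1,$$ $\Delta_\alpha^j u$ is differentiable on $(0,\infty)$ with $$\lim_{r\to\infty}\Delta_\alpha^ju(r)=\lim_{r\to\infty}(\Delta_\alpha^ju)'(r)=0\qquad\text{for }j=0,1,\dots,m,$$ and, with all integrals absolutely convergent, $$(-\Delta_\alpha)^ju(r)=\int_r^\infty t^{-\alpha}\Big(\int_0^t(-\Delta_\alpha)^{j+1}u(s)\,s^\alpha\,ds\Big)dt\qquad\text{for all } r>0,\ j=0,1,\dots,m-1 .$$ -/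

import Mathlib

open Set Filter Topology MeasureTheory
open scoped ENNReal

namespace RadialPoly

/-- The weighted measure `r ^ α dr` on the half-line `(0, ∞)`. The weighted Lebesgue space
`L^p_α(0, ∞)` is `MemLp · p (weightMeasure α)`. -/
noncomputable def weightMeasure (α : ℝ) : Measure ℝ :=
  (volume.restrict (Ioi 0)).withDensity fun r => ENNReal.ofReal (r ^ α)

/-- Local absolute continuity on `(0, ∞)`: absolute continuity on every compact subinterval. -/
def ACLoc (f : ℝ → ℝ) : Prop :=
  ∀ a b : ℝ, 0 < a → a ≤ b → AbsolutelyContinuousOnInterval f a b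

/-- The class `AC^l_loc(0, ∞)`: functions with derivatives up to order `l` on `(0, ∞)` whose
`l`-th derivative is locally absolutely continuous. Functions on `(0, ∞)` are represented by
functions `ℝ → ℝ`, whose values on `(-∞, 0]` play no role. -/
def ACLocOrder (l : ℕ) (u : ℝ → ℝ) : Prop :=
  ContDiffOn ℝ l u (Ioi 0) ∧ ACLoc (iteratedDeriv l u)

/-- The space `D_{0,∞}(α, m, 2)` (for `m ≥ 1`): functions of class `AC^{m-1}_loc(0, ∞)` whose
derivatives of order `0, …, m - 1` vanish at infinity and whose `m`-th derivative, which exists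
almost everywhere, lies in `L^2_α(0, ∞)`. -/
structure MemD0 (m : ℕ) (α : ℝ) (u : ℝ → ℝ) : Prop where
  acLoc : ACLocOrder (m - 1) u
  tendsto_zero : ∀ j < m, Tendsto (iteratedDeriv j u) atTop (𝓝 0)
  memLp : MemLp (iteratedDeriv m u) 2 (weightMeasure α)

/-- The norm `‖u^{(m)}‖_{L^2_α}` (with values in `[0, ∞]`). -/
noncomputable def dirichletNorm (m : ℕ) (α : ℝ) (u : ℝ → ℝ) : ℝ≥0∞ :=
  eLpNorm (iteratedDeriv m u) 2 (weightMeasure α)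

/-- The space `𝒟^{m,2}_∞(α)`, the completion of `D_{0,∞}(α, m, 2)` under the norm
`‖u^{(m)}‖_{L^2_α}`, realised as a space of functions on `(0, ∞)`: the element of the completion
given by a Cauchy sequence is the pointwise limit of that sequence. (If `α - 2m + 1 > 0`, point
evaluations at `r > 0` are continuous for the norm, so each Cauchy sequence has such a limit, and
two Cauchy sequences have the same limit exactly when they are equivalent.) -/
def MemD (m : ℕ) (α : ℝ) (u : ℝ → ℝ) : Prop :=
  ∃ U : ℕ → ℝ → ℝ, (∀ n, MemD0 m α (U n)) ∧
    Tendsto (fun p : ℕ × ℕ => dirichletNorm m α (U p.1 - U p.2)) atTop (𝓝 0) ∧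
    ∀ r : ℝ, 0 < r → Tendsto (fun n => U n r) atTop (𝓝 (u r))

/-- The generalized radial Laplacian `Δ_α u = u'' + (α / r) u'`. -/
noncomputable def lap (α : ℝ) (u : ℝ → ℝ) : ℝ → ℝ :=
  fun r => deriv (deriv u) r + α / r * deriv u r

/-- The power `(-Δ_α)^j u = (-1)^j Δ_α^j u`. -/
noncomputable def negLapPow (α : ℝ) (j : ℕ) (u : ℝ → ℝ) : ℝ → ℝ :=
  fun r => (-1) ^ j * (lap α)^[j] u r

/-- The gradient of order `m`: `∇^m_α u = Δ_α^k u` if `m = 2k`, and `∇^m_α u = (Δ_α^k u)'` if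
`m = 2k + 1`. -/
noncomputable def grad (α : ℝ) (m : ℕ) (u : ℝ → ℝ) : ℝ → ℝ :=
  if Even m then (lap α)^[m / 2] u else deriv ((lap α)^[m / 2] u)

/-- The critical exponent `2^* = 2(α + 1)/(α - 2m + 1)`. -/
noncomputable def critExp (m : ℕ) (α : ℝ) : ℝ := 2 * (α + 1) / (α - 2 * m + 1)

/-- The nonlinearity `|u|^{2^* - 2} u`. -/
noncomputable def critNonlin (m : ℕ) (α : ℝ) (u : ℝ → ℝ) : ℝ → ℝ :=
  fun r => |u r| ^ (critExp m α - 2) * u r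

/-- `u ∈ 𝒟^{m,2}_∞(α)` is a weak solution of `(-Δ_α)^m u = |u|^{2^* - 2} u` in `(0, ∞)`. -/
def IsWeakSolution (m : ℕ) (α : ℝ) (u : ℝ → ℝ) : Prop :=
  MemD m α u ∧ ∀ v : ℝ → ℝ, MemD m α v →
    ∫ r in Ioi (0 : ℝ), grad α m u r * grad α m v r * r ^ α =
      ∫ r in Ioi (0 : ℝ), critNonlin m α u r * v r * r ^ α

end RadialPoly

open RadialPoly

/-!
# Regularity of weak solutions of the critical radial polyharmonic equation

Write `G = greenInt α` for the operator `h ↦ ∫_r^∞ t^{-α} ∫_0^t h(s) s^α ds dt`, a right inverse of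
`-Δ_α`. The whole theorem follows from the identity `u = G^m f`, where `f = |u|^{2^* - 2} u`
(`IsWeakSolution.eq_iterate_greenInt`), together with power bounds.

*Power bounds.* A function in `𝒟^{m,2}_∞(α)` is the `m`-th primitive, vanishing at infinity, of an
`L^2_α` function (`MemD.exists_eq_tailIter`), so Cauchy–Schwarz gives `u = O(r^{-(α - 2m + 1)/2})`
on all of `(0, ∞)` and `f = O(r^{-(α + 2m + 1)/2})`. The operator `G` maps `O(r^{-β})` to
`O(r^{2 - β})` for `2 < β < α + 1`, so it can be applied `m` times to `O(r^{-β})` whenever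
`2m < β < α + 1`. The exponent of `f` is the midpoint of this interval. Hence `G^m f` is of class
`C^{2m}`, and its radial gradients of order `k` are `O(r^{-(α - 2m + 1)/2 - k})`
(`chain_iterate_greenInt`); all the limits in the theorem are read off from these exponents.

*The identity.* For a smooth `g` with compact support in `(0, ∞)` the function `v = G^m g` is an
admissible test function (`memD0_iterate_greenInt`). Its radial gradients are bounded by two powers
of `r`, coming from exponents `β` on either side of the midpoint, and this is what makes every
pairing converge and every boundary term vanish when radial gradients are moved between factors
(`integral_chain_mul_transfer`). Moving the `m` remaining derivatives from `u` onto `v`, and `2m`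
derivatives from `G^m f` onto `v`, turns the weak equation into `∫ u g r^α = ∫ (G^m f) g r^α`.
-/

namespace RadialPoly

/-! ### Power bounds -/

/-- `h = O(r ^ p)` uniformly on the whole half-line `(0, ∞)`. -/
def PowBound (p : ℝ) (h : ℝ → ℝ) : Prop :=
  ∃ C : ℝ, ∀ r : ℝ, 0 < r → |h r| ≤ C * r ^ p

namespace PowBound

variable {p q : ℝ} {h g : ℝ → ℝ}

lemma exists_nonneg (hh : PowBound p h) : ∃ C : ℝ, 0 ≤ C ∧ ∀ r : ℝ, 0 < r → |h r| ≤ C * r ^ p := by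
  obtain ⟨C, hC⟩ := hh
  refine ⟨C, ?_, hC⟩
  have := (abs_nonneg _).trans (hC 1 one_pos)
  simpa using this

lemma congr (hh : PowBound p h) (e : EqOn g h (Ioi 0)) : PowBound p g := by
  obtain ⟨C, hC⟩ := hh
  exact ⟨C, fun r hr => by rw [e hr]; exact hC r hr⟩

lemma cast_exp (hh : PowBound p h) (e : p = q) : PowBound q h := e ▸ hh

lemma add (hh : PowBound p h) (hg : PowBound p g) : PowBound p (fun r => h r + g r) := by
  obtain ⟨C, hC⟩ := hh
  obtain ⟨D, hD⟩ := hg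
  refine ⟨C + D, fun r hr => (abs_add_le _ _).trans ?_⟩
  rw [add_mul]
  exact add_le_add (hC r hr) (hD r hr)

lemma mul (hh : PowBound p h) (hg : PowBound q g) : PowBound (p + q) (fun r => h r * g r) := by
  obtain ⟨C, hC0, hC⟩ := hh.exists_nonneg
  obtain ⟨D, hD⟩ := hg
  refine ⟨C * D, fun r hr => ?_⟩
  rw [abs_mul, Real.rpow_add hr]
  calc |h r| * |g r| ≤ (C * r ^ p) * (D * r ^ q) :=
        mul_le_mul (hC r hr) (hD r hr) (abs_nonneg _) (mul_nonneg hC0 (Real.rpow_nonneg hr.le _))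
    _ = _ := by ring

lemma rpow (p : ℝ) : PowBound p (fun r => r ^ p) :=
  ⟨1, fun r hr => by rw [abs_of_nonneg (Real.rpow_nonneg hr.le _), one_mul]⟩

lemma zero (p : ℝ) : PowBound p (fun _ => 0) := ⟨0, fun r _ => by simp⟩

lemma const_mul (hh : PowBound p h) (c : ℝ) : PowBound p (fun r => c * h r) := by
  obtain ⟨C, hC⟩ := hh
  refine ⟨|c| * C, fun r hr => ?_⟩
  rw [abs_mul, mul_assoc]
  exact mul_le_mul_of_nonneg_left (hC r hr) (abs_nonneg _)

lemma sum {ι : Type*} (s : Finset ι) {F : ι → ℝ → ℝ} (hF : ∀ i ∈ s, PowBound p (F i)) :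
    PowBound p (fun r => ∑ i ∈ s, F i r) := by
  classical
  induction s using Finset.induction_on with
  | empty => simpa using zero p
  | insert a s ha ih =>
    simp only [Finset.sum_insert ha]
    exact (hF a (Finset.mem_insert_self _ _)).add
      (ih fun i hi => hF i (Finset.mem_insert_of_mem hi))

lemma integrableOn_Ioi (hh : PowBound p h) (hc : ContinuousOn h (Ioi 0)) (hp : p < -1)
    {r : ℝ} (hr : 0 < r) : IntegrableOn h (Ioi r) := by
  obtain ⟨C, hC⟩ := hh
  have hs : Ioi r ⊆ Ioi 0 := Ioi_subset_Ioi hr.le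
  refine Integrable.mono' ((integrableOn_Ioi_rpow_of_lt hp hr).const_mul C)
    ((hc.mono hs).aestronglyMeasurable measurableSet_Ioi) ?_
  filter_upwards [ae_restrict_mem measurableSet_Ioi] with t ht
  exact hC t (hs ht)

lemma integrableOn_Ioc (hh : PowBound p h) (hc : ContinuousOn h (Ioi 0)) (hp : -1 < p)
    (r : ℝ) : IntegrableOn h (Ioc 0 r) := by
  obtain ⟨C, hC⟩ := hh
  refine Integrable.mono' (g := fun t => C * t ^ p) ?_
    ((hc.mono Ioc_subset_Ioi_self).aestronglyMeasurable measurableSet_Ioc) ?_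
  · have := (intervalIntegral.intervalIntegrable_rpow' (a := 0) (b := r) hp).const_mul C
    exact this.1
  filter_upwards [ae_restrict_mem measurableSet_Ioc] with t ht
  exact hC t ht.1

lemma integrableOn_Ioi_zero (h1 : PowBound p h) (h2 : PowBound q h) (hc : ContinuousOn h (Ioi 0))
    (hp : -1 < p) (hq : q < -1) : IntegrableOn h (Ioi 0) := by
  rw [← Ioc_union_Ioi_eq_Ioi (zero_le_one (α := ℝ))]
  exact (h1.integrableOn_Ioc hc hp 1).union (h2.integrableOn_Ioi hc hq one_pos)

lemma tendsto_atTop (hh : PowBound p h) (hp : p < 0) : Tendsto h atTop (𝓝 0) := by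
  obtain ⟨C, hC⟩ := hh
  have : Tendsto (fun r : ℝ => C * r ^ p) atTop (𝓝 0) := by
    have := (tendsto_rpow_neg_atTop (neg_pos.2 hp)).const_mul C
    simpa using this
  refine squeeze_zero_norm' ?_ this
  filter_upwards [eventually_gt_atTop 0] with r hr using hC r hr

lemma tendsto_zero (hh : PowBound p h) (hp : 0 < p) : Tendsto h (𝓝[>] 0) (𝓝 0) := by
  obtain ⟨C, hC⟩ := hh
  have : Tendsto (fun r : ℝ => C * r ^ p) (𝓝[>] 0) (𝓝 0) := by
    have h1 : ContinuousAt (fun r : ℝ => C * r ^ p) 0 :=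
      continuousAt_const.mul (Real.continuousAt_rpow_const 0 p (Or.inr hp.le))
    have h2 := h1.tendsto
    simp only [Real.zero_rpow hp.ne', mul_zero] at h2
    exact h2.mono_left nhdsWithin_le_nhds
  refine squeeze_zero_norm' ?_ this
  filter_upwards [self_mem_nhdsWithin] with r hr using hC r hr

lemma abs_tail_le {C : ℝ} (hC : ∀ r : ℝ, 0 < r → |h r| ≤ C * r ^ p) (hp : p < -1) {r : ℝ}
    (hr : 0 < r) : |∫ t in Ioi r, h t| ≤ C * (-1 / (p + 1)) * r ^ (p + 1) := by
  have h1 : ‖∫ t in Ioi r, h t‖ ≤ ∫ t in Ioi r, C * t ^ p := by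
    refine norm_integral_le_of_norm_le ((integrableOn_Ioi_rpow_of_lt hp hr).const_mul C) ?_
    filter_upwards [ae_restrict_mem measurableSet_Ioi] with t ht
    exact hC t (hr.trans ht)
  rw [integral_const_mul, integral_Ioi_rpow_of_lt hp hr] at h1
  refine h1.trans (le_of_eq ?_)
  ring

lemma tail (hh : PowBound p h) (hp : p < -1) :
    PowBound (p + 1) (fun r => ∫ t in Ioi r, h t) := by
  obtain ⟨C, hC⟩ := hh
  exact ⟨C * (-1 / (p + 1)), fun r hr => abs_tail_le hC hp hr⟩

lemma head (hh : PowBound p h) (hp : -1 < p) :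
    PowBound (p + 1) (fun r => ∫ t in Ioc 0 r, h t) := by
  obtain ⟨C, hC⟩ := hh
  refine ⟨C * (1 / (p + 1)), fun r hr => ?_⟩
  have hi := (intervalIntegral.intervalIntegrable_rpow' (a := 0) (b := r) hp).const_mul C
  have h1 : ‖∫ t in Ioc 0 r, h t‖ ≤ ∫ t in Ioc 0 r, C * t ^ p := by
    refine norm_integral_le_of_norm_le hi.1 ?_
    filter_upwards [ae_restrict_mem measurableSet_Ioc] with t ht
    exact hC t ht.1
  rw [integral_const_mul, ← intervalIntegral.integral_of_le (f := fun t => t ^ p) hr.le,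
    integral_rpow (Or.inl hp),
    Real.zero_rpow (by linarith)] at h1
  refine h1.trans (le_of_eq ?_)
  ring

end PowBound

lemma hasDerivAt_tail {h : ℝ → ℝ} (hc : ContinuousOn h (Ioi 0))
    (hi : ∀ r : ℝ, 0 < r → IntegrableOn h (Ioi r)) {r : ℝ} (hr : 0 < r) :
    HasDerivAt (fun r => ∫ t in Ioi r, h t) (-h r) r := by
  have h1 : HasDerivAt (fun x => ∫ t in (r / 2)..x, h t) (h r) r := by
    apply intervalIntegral.integral_hasDerivAt_right
    · rw [intervalIntegrable_iff_integrableOn_Ioc_of_le (by linarith)]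
      exact (hi (r / 2) (by positivity)).mono_set Ioc_subset_Ioi_self
    · exact hc.stronglyMeasurableAtFilter isOpen_Ioi r hr
    · exact hc.continuousAt (Ioi_mem_nhds hr)
  have h2 := h1.const_sub (∫ t in Ioi (r / 2), h t)
  refine h2.congr_of_eventuallyEq ?_
  filter_upwards [Ioi_mem_nhds (show r / 2 < r by linarith)] with x hx
  rw [← intervalIntegral.integral_Ioi_sub_Ioi (hi _ (by positivity)) (le_of_lt hx)]
  ring

lemma hasDerivAt_head {h : ℝ → ℝ} (hc : ContinuousOn h (Ioi 0))
    (hi : ∀ r : ℝ, IntegrableOn h (Ioc 0 r)) {r : ℝ} (hr : 0 < r) :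
    HasDerivAt (fun r => ∫ t in Ioc 0 r, h t) (h r) r := by
  have h1 : HasDerivAt (fun x => ∫ t in (0 : ℝ)..x, h t) (h r) r := by
    apply intervalIntegral.integral_hasDerivAt_right
    · rw [intervalIntegrable_iff_integrableOn_Ioc_of_le hr.le]
      exact hi r
    · exact hc.stronglyMeasurableAtFilter isOpen_Ioi r hr
    · exact hc.continuousAt (Ioi_mem_nhds hr)
  refine h1.congr_of_eventuallyEq ?_
  filter_upwards [Ioi_mem_nhds hr] with x hx
  rw [intervalIntegral.integral_of_le (le_of_lt hx)]

/-! ### Radial gradients and the Green operator -/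

/-- The coefficient of the zeroth-order term `u / r` in the `k`-th factor of `Δ_α^j`: factors of
even index are `d/dr`, those of odd index are `d/dr + α / r`. -/
noncomputable def chainCoeff (α : ℝ) (k : ℕ) : ℝ := if Even k then 0 else α

/-- The radial gradients of all orders, `∇^k_α u`, generated by alternately applying `d/dr` and
`d/dr + α / r`. -/
noncomputable def chain (α : ℝ) (u : ℝ → ℝ) : ℕ → ℝ → ℝ
  | 0 => u
  | k + 1 => fun r => deriv (chain α u k) r + chainCoeff α k / r * chain α u k r

lemma chain_zero (α : ℝ) (u : ℝ → ℝ) : chain α u 0 = u := rfl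

lemma chain_succ (α : ℝ) (u : ℝ → ℝ) (k : ℕ) (r : ℝ) :
    chain α u (k + 1) r = deriv (chain α u k) r + chainCoeff α k / r * chain α u k r := rfl

lemma chain_succ_of_even (α : ℝ) (u : ℝ → ℝ) {k : ℕ} (hk : Even k) :
    chain α u (k + 1) = deriv (chain α u k) := by
  ext r
  simp [chain_succ, chainCoeff, hk]

lemma chain_two (α : ℝ) (u : ℝ → ℝ) : chain α u 2 = lap α u := by
  ext r
  rw [show (2 : ℕ) = 1 + 1 from rfl, chain_succ, chain_succ_of_even α u (k := 0) (by simp),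
    chain_zero]
  simp [chainCoeff, lap]

lemma chainCoeff_add_two (α : ℝ) (k : ℕ) : chainCoeff α (k + 2) = chainCoeff α k := by
  simp [chainCoeff, Nat.even_add]

lemma chain_add_two (α : ℝ) (u : ℝ → ℝ) (k : ℕ) :
    chain α u (k + 2) = chain α (lap α u) k := by
  induction k with
  | zero => exact chain_two α u
  | succ k ih =>
    ext r
    rw [show k + 1 + 2 = (k + 2) + 1 from rfl, chain_succ, ih, chainCoeff_add_two, chain_succ]

lemma chain_two_mul (α : ℝ) (u : ℝ → ℝ) (j : ℕ) : chain α u (2 * j) = (lap α)^[j] u := by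
  induction j generalizing u with
  | zero => rfl
  | succ j ih => rw [Nat.mul_succ, chain_add_two, ih, Function.iterate_succ_apply]

lemma chain_eq_grad (α : ℝ) (u : ℝ → ℝ) (m : ℕ) : chain α u m = grad α m u := by
  unfold grad
  split_ifs with h
  · obtain ⟨k, rfl⟩ := h
    rw [← two_mul, chain_two_mul]
    congr 2
    omega
  · obtain ⟨k, rfl⟩ := Nat.not_even_iff_odd.1 h
    rw [chain_succ_of_even α u (by simp), chain_two_mul]
    congr 3
    omega

lemma chain_congr (α : ℝ) {u w : ℝ → ℝ} (h : EqOn u w (Ioi 0)) (k : ℕ) :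
    EqOn (chain α u k) (chain α w k) (Ioi 0) := by
  induction k with
  | zero => exact h
  | succ k ih =>
    intro r hr
    rw [chain_succ, chain_succ, ih hr, ih.deriv isOpen_Ioi hr]

lemma chain_neg (α : ℝ) (u : ℝ → ℝ) (k : ℕ) :
    chain α (fun r => -u r) k = fun r => -chain α u k r := by
  induction k with
  | zero => rfl
  | succ k ih =>
    ext r
    rw [chain_succ, ih, chain_succ, deriv.fun_neg]
    ring

/-- The integral operator `h ↦ ∫_r^∞ t^{-α} ∫_0^t h(s) s^α ds dt`, an inverse of `-Δ_α`. -/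
noncomputable def greenInt (α : ℝ) (h : ℝ → ℝ) (r : ℝ) : ℝ :=
  ∫ t in Ioi r, t ^ (-α) * ∫ s in Ioc 0 t, h s * s ^ α

section Green

variable {α β : ℝ} {h : ℝ → ℝ}

lemma continuousOn_rpow (p : ℝ) : ContinuousOn (fun r : ℝ => r ^ p) (Ioi 0) :=
  fun r hr => (Real.continuousAt_rpow_const r p (Or.inl (ne_of_gt hr))).continuousWithinAt

lemma powBound_mul_rpow (hb : PowBound (-β) h) : PowBound (α - β) (fun s => h s * s ^ α) :=
  (hb.mul (PowBound.rpow α)).cast_exp (by ring)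

lemma integrableOn_mul_rpow (hc : ContinuousOn h (Ioi 0)) (hb : PowBound (-β) h) (hβ : β < α + 1)
    (t : ℝ) : IntegrableOn (fun s => h s * s ^ α) (Ioc 0 t) :=
  (powBound_mul_rpow hb).integrableOn_Ioc (hc.mul (continuousOn_rpow α)) (by linarith) t

lemma hasDerivAt_head_mul_rpow (hc : ContinuousOn h (Ioi 0)) (hb : PowBound (-β) h)
    (hβ : β < α + 1) {r : ℝ} (hr : 0 < r) :
    HasDerivAt (fun t => ∫ s in Ioc 0 t, h s * s ^ α) (h r * r ^ α) r :=
  hasDerivAt_head (h := fun s => h s * s ^ α) (hc.mul (continuousOn_rpow α))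
    (integrableOn_mul_rpow hc hb hβ) hr

lemma powBound_flux (hb : PowBound (-β) h) (hβ : β < α + 1) :
    PowBound (1 - β) (fun t => t ^ (-α) * ∫ s in Ioc 0 t, h s * s ^ α) :=
  ((PowBound.rpow (-α)).mul ((powBound_mul_rpow hb).head (by linarith))).cast_exp (by ring)

lemma hasDerivAt_flux (hc : ContinuousOn h (Ioi 0)) (hb : PowBound (-β) h) (hβ : β < α + 1)
    {r : ℝ} (hr : 0 < r) :
    HasDerivAt (fun t => t ^ (-α) * ∫ s in Ioc 0 t, h s * s ^ α)
      (-α / r * (r ^ (-α) * ∫ s in Ioc 0 r, h s * s ^ α) + h r) r := by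
  have h1 := (Real.hasDerivAt_rpow_const (x := r) (p := -α) (Or.inl hr.ne')).mul
    (hasDerivAt_head_mul_rpow hc hb hβ hr)
  refine h1.congr_deriv ?_
  rw [Real.rpow_sub hr, Real.rpow_one, Real.rpow_neg hr.le]
  have := (Real.rpow_pos_of_pos hr α).ne'
  field_simp

lemma continuousOn_flux (hc : ContinuousOn h (Ioi 0)) (hb : PowBound (-β) h) (hβ : β < α + 1) :
    ContinuousOn (fun t => t ^ (-α) * ∫ s in Ioc 0 t, h s * s ^ α) (Ioi 0) :=
  fun _ hr => (hasDerivAt_flux hc hb hβ hr).continuousAt.continuousWithinAt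

lemma integrableOn_flux (hc : ContinuousOn h (Ioi 0)) (hb : PowBound (-β) h) (hβ2 : 2 < β)
    (hβ : β < α + 1) {r : ℝ} (hr : 0 < r) :
    IntegrableOn (fun t => t ^ (-α) * ∫ s in Ioc 0 t, h s * s ^ α) (Ioi r) :=
  (powBound_flux hb hβ).integrableOn_Ioi (continuousOn_flux hc hb hβ) (by linarith) hr

lemma powBound_greenInt (hb : PowBound (-β) h) (hβ2 : 2 < β) (hβ : β < α + 1) :
    PowBound (2 - β) (greenInt α h) :=
  ((powBound_flux hb hβ).tail (by linarith)).cast_exp (by ring)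

lemma hasDerivAt_greenInt (hc : ContinuousOn h (Ioi 0)) (hb : PowBound (-β) h) (hβ2 : 2 < β)
    (hβ : β < α + 1) {r : ℝ} (hr : 0 < r) :
    HasDerivAt (greenInt α h) (-(r ^ (-α) * ∫ s in Ioc 0 r, h s * s ^ α)) r :=
  hasDerivAt_tail (h := fun t => t ^ (-α) * ∫ s in Ioc 0 t, h s * s ^ α)
    (continuousOn_flux hc hb hβ) (fun _ => integrableOn_flux hc hb hβ2 hβ) hr

lemma continuousOn_greenInt (hc : ContinuousOn h (Ioi 0)) (hb : PowBound (-β) h) (hβ2 : 2 < β)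
    (hβ : β < α + 1) : ContinuousOn (greenInt α h) (Ioi 0) :=
  fun _ hr => (hasDerivAt_greenInt hc hb hβ2 hβ hr).continuousAt.continuousWithinAt

lemma chain_one_greenInt (hc : ContinuousOn h (Ioi 0)) (hb : PowBound (-β) h) (hβ2 : 2 < β)
    (hβ : β < α + 1) : EqOn (chain α (greenInt α h) 1)
      (fun t => -(t ^ (-α) * ∫ s in Ioc 0 t, h s * s ^ α)) (Ioi 0) := by
  intro r hr
  rw [chain_succ_of_even α _ (k := 0) (by simp), chain_zero]
  exact (hasDerivAt_greenInt hc hb hβ2 hβ hr).deriv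

/-- `-Δ_α` inverts `greenInt`. -/
lemma lap_greenInt (hc : ContinuousOn h (Ioi 0)) (hb : PowBound (-β) h) (hβ2 : 2 < β)
    (hβ : β < α + 1) : EqOn (lap α (greenInt α h)) (fun r => -h r) (Ioi 0) := by
  intro r hr
  have e := chain_one_greenInt hc hb hβ2 hβ
  rw [← chain_two, chain_succ, e.deriv isOpen_Ioi hr, e hr,
    (hasDerivAt_flux hc hb hβ hr).fun_neg.deriv]
  simp only [chainCoeff]
  rw [if_neg (by simp)]
  ring

lemma greenInt_congr {g : ℝ → ℝ} (e : EqOn g h (Ioi 0)) (r : ℝ) :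
    greenInt α g r = greenInt α h r := by
  unfold greenInt
  refine setIntegral_congr_fun measurableSet_Ioi fun t _ => congrArg _ ?_
  refine setIntegral_congr_fun measurableSet_Ioc fun s hs => ?_
  simp only [e hs.1]

lemma contDiffOn_rpow (p : ℝ) (n : ℕ) : ContDiffOn ℝ n (fun r : ℝ => r ^ p) (Ioi 0) :=
  fun _ hr => (Real.contDiffAt_rpow_const_of_ne (ne_of_gt hr)).contDiffWithinAt

lemma contDiffOn_succ_of_hasDerivAt {F F' : ℝ → ℝ} {n : ℕ}
    (hF : ∀ r : ℝ, 0 < r → HasDerivAt F (F' r) r) (h' : ContDiffOn ℝ n F' (Ioi 0)) :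
    ContDiffOn ℝ (n + 1 : ℕ) F (Ioi 0) := by
  have := (contDiffOn_succ_iff_deriv_of_isOpen (𝕜 := ℝ) (f := F) (n := (n : WithTop ℕ∞))
    (s := Ioi (0 : ℝ)) isOpen_Ioi).2
    ⟨fun r hr => (hF r hr).differentiableAt.differentiableWithinAt, by simp,
      h'.congr fun r hr => (hF r hr).deriv⟩
  exact_mod_cast this

lemma contDiffOn_greenInt {n : ℕ} (hn : ContDiffOn ℝ n h (Ioi 0)) (hb : PowBound (-β) h)
    (hβ2 : 2 < β) (hβ : β < α + 1) : ContDiffOn ℝ (n + 2 : ℕ) (greenInt α h) (Ioi 0) := by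
  have hc := hn.continuousOn
  refine contDiffOn_succ_of_hasDerivAt
    (fun r hr => hasDerivAt_greenInt hc hb hβ2 hβ hr) ?_
  refine ((contDiffOn_rpow _ _).mul ?_).neg
  exact contDiffOn_succ_of_hasDerivAt (fun r hr => hasDerivAt_head_mul_rpow hc hb hβ hr)
    (hn.mul (contDiffOn_rpow _ _))

lemma iterate_greenInt (hc : ContinuousOn h (Ioi 0)) (hb : PowBound (-β) h) (hβ : β < α + 1)
    (i : ℕ) (hi : 2 * (i : ℝ) < β) :
    ContDiffOn ℝ (2 * i : ℕ) ((greenInt α)^[i] h) (Ioi 0) ∧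
      PowBound (-(β - 2 * i)) ((greenInt α)^[i] h) := by
  induction i with
  | zero => simpa using ⟨hc, hb⟩
  | succ i ih =>
    push_cast at hi
    obtain ⟨h1, h2⟩ := ih (by linarith)
    rw [Function.iterate_succ_apply']
    refine ⟨contDiffOn_greenInt h1 h2 (by linarith) ?_,
      (powBound_greenInt h2 (by linarith) ?_).cast_exp (by push_cast; ring)⟩ <;>
    · have : (0 : ℝ) ≤ i := Nat.cast_nonneg i
      linarith

/-- The radial gradients of the `m`-th iterate `w` of `greenInt` on `h = O(r^{-β})` satisfy
`∇^k_α w = O(r^{2m - k - β})`, as if `w` were a multiple of `r ^ (2m - β)`. -/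
lemma chain_iterate_greenInt (hc : ContinuousOn h (Ioi 0)) (hb : PowBound (-β) h)
    (hβ : β < α + 1) (m : ℕ) (hm : 2 * (m : ℝ) < β) :
    (∀ k ≤ 2 * m, ContinuousOn (chain α ((greenInt α)^[m] h) k) (Ioi 0) ∧
      PowBound (2 * m - k - β) (chain α ((greenInt α)^[m] h) k)) ∧
    (∀ k < 2 * m, ContDiffOn ℝ 1 (chain α ((greenInt α)^[m] h) k) (Ioi 0)) ∧
    EqOn (chain α ((greenInt α)^[m] h) (2 * m)) (fun r => (-1) ^ m * h r) (Ioi 0) := by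
  induction m with
  | zero =>
    refine ⟨fun k hk => ?_, fun k hk => by omega, fun r _ => by simp [chain_zero]⟩
    obtain rfl : k = 0 := by omega
    exact ⟨hc, hb.cast_exp (by simp)⟩
  | succ m ih =>
    push_cast at hm
    obtain ⟨h1, h2⟩ := iterate_greenInt hc hb hβ m (by linarith)
    obtain ⟨i1, i2, i3⟩ := ih (by linarith)
    have hβ' : β - 2 * m < α + 1 := by
      have : (0 : ℝ) ≤ m := Nat.cast_nonneg m
      linarith
    have hβ2 : 2 < β - 2 * m := by linarith
    rw [Function.iterate_succ_apply']
    set w := (greenInt α)^[m] h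
    have e1 := chain_one_greenInt h1.continuousOn h2 hβ2 hβ'
    have e2 : ∀ k, EqOn (chain α (greenInt α w) (k + 2)) (fun r => -chain α w k r) (Ioi 0) := by
      intro k
      rw [chain_add_two, ← chain_neg]
      exact chain_congr α (lap_greenInt h1.continuousOn h2 hβ2 hβ') k
    refine ⟨fun k hk => ?_, fun k hk => ?_, ?_⟩
    · match k, hk with
      | 0, _ => exact ⟨continuousOn_greenInt h1.continuousOn h2 hβ2 hβ',
          (powBound_greenInt h2 hβ2 hβ').cast_exp (by push_cast; ring)⟩
      | 1, _ =>
        refine ⟨(continuousOn_flux h1.continuousOn h2 hβ').neg.congr e1,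
          PowBound.congr ?_ e1⟩
        exact (((powBound_flux h2 hβ').const_mul (-1)).congr
          (fun r _ => by ring)).cast_exp (by push_cast; ring)
      | k + 2, hk =>
        obtain ⟨j1, j2⟩ := i1 k (by omega)
        refine ⟨j1.neg.congr (e2 k), PowBound.congr ?_ (e2 k)⟩
        exact ((j2.const_mul (-1)).congr (fun r _ => by ring)).cast_exp (by push_cast; ring)
    · match k, hk with
      | 0, _ =>
        exact (contDiffOn_greenInt (n := 0) (h1.of_le (by simp)) h2 hβ2 hβ').of_le (by norm_num)
      | 1, _ =>
        have := contDiffOn_succ_of_hasDerivAt (n := 0)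
          (fun r hr => hasDerivAt_flux h1.continuousOn h2 hβ' hr) ?_
        · exact (ContDiffOn.neg (by simpa using this)).congr e1
        · rw [Nat.cast_zero, contDiffOn_zero]
          refine ContinuousOn.add (ContinuousOn.mul ?_ (continuousOn_flux h1.continuousOn h2 hβ'))
            h1.continuousOn
          exact continuousOn_const.div continuousOn_id fun r hr => ne_of_gt hr
      | k + 2, hk => exact (i2 k (by omega)).neg.congr (e2 k)
    · intro r hr
      rw [Nat.mul_succ, e2 _ hr]
      simp only [i3 hr]
      ring

end Green

/-! ### Absolutely continuous functions on the half-line -/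

namespace ACLoc

variable {f g : ℝ → ℝ}

lemma congr (hf : ACLoc f) (e : EqOn g f (Ioi 0)) : ACLoc g := by
  intro a b ha hab
  have h := (absolutelyContinuousOnInterval_iff f a b).1 (hf a b ha hab)
  refine (absolutelyContinuousOnInterval_iff g a b).2 fun ε hε => ?_
  obtain ⟨δ, hδ, H⟩ := h ε hε
  refine ⟨δ, hδ, fun E hE hlt => ?_⟩
  have hs : uIcc a b ⊆ Ioi 0 := by
    rw [uIcc_of_le hab]
    exact fun x hx => lt_of_lt_of_le ha hx.1
  rw [Finset.sum_congr rfl fun i hi => by rw [e (hs (hE.1 i hi).1), e (hs (hE.1 i hi).2)]]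
  exact H E hE hlt

lemma of_contDiffOn (hf : ContDiffOn ℝ 1 f (Ioi 0)) : ACLoc f := by
  intro a b ha hab
  refine (hf.mono ?_).absolutelyContinuousOnInterval
  rw [uIcc_of_le hab]
  exact fun x hx => lt_of_lt_of_le ha hx.1

lemma mul (hf : ACLoc f) (hg : ACLoc g) : ACLoc (fun r => f r * g r) :=
  fun a b ha hab => (hf a b ha hab).fun_mul (hg a b ha hab)

lemma add (hf : ACLoc f) (hg : ACLoc g) : ACLoc (fun r => f r + g r) :=
  fun a b ha hab => (hf a b ha hab).fun_add (hg a b ha hab)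

lemma const_mul (hf : ACLoc f) (c : ℝ) : ACLoc (fun r => c * f r) :=
  fun a b ha hab => (hf a b ha hab).const_mul c

lemma const (c : ℝ) : ACLoc (fun _ => c) := of_contDiffOn contDiffOn_const

lemma rpow (p : ℝ) : ACLoc (fun r => r ^ p) :=
  of_contDiffOn (by simpa using contDiffOn_rpow p 1)

lemma sum {ι : Type*} (s : Finset ι) {F : ι → ℝ → ℝ} (hF : ∀ i ∈ s, ACLoc (F i)) :
    ACLoc (fun r => ∑ i ∈ s, F i r) := by
  classical
  induction s using Finset.induction_on with
  | empty => simpa using const 0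
  | insert a s ha ih =>
    simp only [Finset.sum_insert ha]
    exact (hF a (Finset.mem_insert_self _ _)).add
      (ih fun i hi => hF i (Finset.mem_insert_of_mem hi))

lemma continuousOn (hf : ACLoc f) : ContinuousOn f (Ioi 0) := by
  intro r hr
  have hr' : (0 : ℝ) < r := hr
  have h := (hf (r / 2) (r + 1) (by positivity) (by linarith)).continuousOn
  refine (h.continuousAt ?_).continuousWithinAt
  rw [uIcc_of_le (by linarith)]
  exact Icc_mem_nhds (by linarith) (by linarith)

end ACLoc

/-- A property that holds at almost every point of each compact subinterval of `(0, ∞)` holds at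
almost every point of `(0, ∞)`. -/
lemma ae_pos_of_forall_Icc {p : ℝ → Prop}
    (h : ∀ a b : ℝ, 0 < a → a ≤ b → ∀ᵐ x, x ∈ Icc a b → p x) : ∀ᵐ x : ℝ, 0 < x → p x := by
  have h1 : ∀ᵐ x : ℝ, ∀ n : ℕ, x ∈ Icc (1 / ((n : ℝ) + 1)) (n + 1) → p x := by
    rw [ae_all_iff]
    intro n
    refine h _ _ (by positivity) ?_
    have : (0 : ℝ) ≤ n := Nat.cast_nonneg n
    rw [div_le_iff₀ (by positivity)]
    nlinarith
  filter_upwards [h1] with x hx hx0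
  obtain ⟨n, hn⟩ := exists_nat_gt (max x (1 / x))
  refine hx n ⟨?_, ?_⟩
  · rw [div_le_iff₀ (by positivity)]
    have := (le_max_right x (1 / x)).trans hn.le
    rw [div_le_iff₀ hx0] at this
    nlinarith
  · linarith [(le_max_left x (1 / x)).trans hn.le]

lemma ACLoc.ae_differentiableAt {f : ℝ → ℝ} (hf : ACLoc f) :
    ∀ᵐ x : ℝ, 0 < x → DifferentiableAt ℝ f x := by
  refine ae_pos_of_forall_Icc fun a b ha hab => ?_
  have := (hf a b ha hab).ae_differentiableAt
  rwa [uIcc_of_le hab] at this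

lemma intervalIntegrable_of_tail {V : ℝ → ℝ} (hV : ∀ r : ℝ, 0 < r → IntegrableOn V (Ioi r))
    {a b : ℝ} (ha : 0 < a) (hab : a ≤ b) : IntervalIntegrable V volume a b := by
  rw [intervalIntegrable_iff_integrableOn_Ioc_of_le hab]
  exact (hV a ha).mono_set Ioc_subset_Ioi_self

lemma neg_tail_eq {V : ℝ → ℝ} (hV : ∀ r : ℝ, 0 < r → IntegrableOn V (Ioi r)) {a r : ℝ}
    (ha : 0 < a) (hr : a ≤ r) :
    -∫ t in Ioi r, V t = (∫ t in a..r, V t) + -∫ t in Ioi a, V t := by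
  rw [← intervalIntegral.integral_Ioi_sub_Ioi (hV a ha) hr]
  ring

lemma acLoc_neg_tail {V : ℝ → ℝ} (hV : ∀ r : ℝ, 0 < r → IntegrableOn V (Ioi r)) :
    ACLoc (fun r => -∫ t in Ioi r, V t) := by
  intro a b ha hab
  have h1 := (intervalIntegrable_of_tail hV ha hab).absolutelyContinuousOnInterval_intervalIntegral
    (c := a) left_mem_uIcc
  have h2 := h1.fun_add (ACLoc.const (-∫ t in Ioi a, V t) a b ha hab)
  rw [absolutelyContinuousOnInterval_iff] at h2 ⊢
  intro ε hε
  obtain ⟨δ, hδ, H⟩ := h2 ε hε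
  refine ⟨δ, hδ, fun E hE hlt => ?_⟩
  have hs : ∀ x ∈ uIcc a b, a ≤ x := fun x hx => by
    rw [uIcc_of_le hab] at hx
    exact hx.1
  rw [Finset.sum_congr rfl fun i hi => by
    rw [neg_tail_eq hV ha (hs _ (hE.1 i hi).1), neg_tail_eq hV ha (hs _ (hE.1 i hi).2)]]
  exact H E hE hlt

lemma ae_hasDerivAt_neg_tail {V : ℝ → ℝ} (hV : ∀ r : ℝ, 0 < r → IntegrableOn V (Ioi r)) :
    ∀ᵐ x : ℝ, 0 < x → HasDerivAt (fun r => -∫ t in Ioi r, V t) (V x) x := by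
  refine ae_pos_of_forall_Icc fun a b ha hab => ?_
  have h := (intervalIntegrable_of_tail hV (a := a / 2) (b := b) (by positivity)
    (by linarith)).ae_hasDerivAt_integral
  filter_upwards [h] with x hx hxab
  rw [uIcc_of_le (by linarith)] at hx
  have h1 := (hx ⟨by linarith [hxab.1], hxab.2⟩ (a / 2) ⟨le_rfl, by linarith⟩).add_const
    (-∫ t in Ioi (a / 2), V t)
  refine h1.congr_of_eventuallyEq ?_
  filter_upwards [Ioi_mem_nhds (show a / 2 < x by linarith [hxab.1])] with y hy
  exact neg_tail_eq hV (by positivity) (le_of_lt hy)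

/-- Fundamental theorem of calculus on `(r, ∞)` for a locally absolutely continuous function
vanishing at infinity. -/
lemma ACLoc.eq_neg_tail {F : ℝ → ℝ} (hF : ACLoc F) (h0 : Tendsto F atTop (𝓝 0))
    (hi : ∀ r : ℝ, 0 < r → IntegrableOn (deriv F) (Ioi r)) {r : ℝ} (hr : 0 < r) :
    F r = -∫ t in Ioi r, deriv F t := by
  have h1 := intervalIntegral_tendsto_integral_Ioi r (hi r hr) tendsto_id
  have h2 : Tendsto (fun b => ∫ t in r..b, deriv F t) atTop (𝓝 (0 - F r)) := by
    refine (h0.sub_const (F r)).congr' ?_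
    filter_upwards [eventually_ge_atTop r] with b hb
    exact ((hF r b hr hb).integral_deriv_eq_sub).symm
  have := tendsto_nhds_unique h1 h2
  rw [this]
  ring

/-! ### The weighted measure -/

section Weight

variable {α : ℝ}

lemma measurable_weight (α : ℝ) : Measurable fun r : ℝ => ENNReal.ofReal (r ^ α) := by fun_prop

lemma ae_weightMeasure_iff {p : ℝ → Prop} :
    (∀ᵐ r ∂weightMeasure α, p r) ↔ ∀ᵐ r : ℝ, 0 < r → p r := by
  rw [weightMeasure, ae_withDensity_iff (measurable_weight α), ae_restrict_iff' measurableSet_Ioi]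
  refine eventually_congr (Eventually.of_forall fun r => ?_)
  refine forall_congr' fun hr => ?_
  have : ENNReal.ofReal (r ^ α) ≠ 0 := by
    simpa using Real.rpow_pos_of_pos hr α
  simp [this]

lemma integrable_weightMeasure_iff {h : ℝ → ℝ} :
    Integrable h (weightMeasure α) ↔ IntegrableOn (fun r => h r * r ^ α) (Ioi 0) := by
  rw [weightMeasure, integrable_withDensity_iff_integrable_smul' (measurable_weight α)
    (by simp), IntegrableOn]
  refine integrable_congr ?_
  filter_upwards [ae_restrict_mem measurableSet_Ioi] with r hr
  rw [ENNReal.toReal_ofReal (Real.rpow_nonneg (le_of_lt hr) _), smul_eq_mul, mul_comm]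

lemma integral_weightMeasure (h : ℝ → ℝ) :
    ∫ r, h r ∂weightMeasure α = ∫ r in Ioi (0 : ℝ), h r * r ^ α := by
  rw [weightMeasure, integral_withDensity_eq_integral_toReal_smul (measurable_weight α)
    (by simp)]
  refine setIntegral_congr_fun measurableSet_Ioi fun r hr => ?_
  rw [ENNReal.toReal_ofReal (Real.rpow_nonneg (le_of_lt hr) _), smul_eq_mul, mul_comm]

lemma aestronglyMeasurable_weightMeasure {h : ℝ → ℝ} (hc : ContinuousOn h (Ioi 0)) :
    AEStronglyMeasurable h (weightMeasure α) :=
  (hc.aestronglyMeasurable measurableSet_Ioi).mono_ac (withDensity_absolutelyContinuous _ _)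

/-- Two power bounds, one for each end of `(0, ∞)`, give square integrability. -/
lemma memLp_of_powBound {h : ℝ → ℝ} {p q : ℝ} (hc : ContinuousOn h (Ioi 0)) (h1 : PowBound p h)
    (h2 : PowBound q h) (hp : -1 < 2 * p + α) (hq : 2 * q + α < -1) :
    MemLp h 2 (weightMeasure α) := by
  rw [memLp_two_iff_integrable_sq (aestronglyMeasurable_weightMeasure hc),
    integrable_weightMeasure_iff]
  refine PowBound.integrableOn_Ioi_zero (p := 2 * p + α) (q := 2 * q + α) ?_ ?_
    ((hc.pow 2).mul (continuousOn_rpow α)) hp hq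
  · refine (((h1.mul h1).mul (PowBound.rpow α)).congr fun r _ => ?_).cast_exp (by ring)
    ring
  · refine (((h2.mul h2).mul (PowBound.rpow α)).congr fun r _ => ?_).cast_exp (by ring)
    ring

/-- Cauchy–Schwarz on `(r, ∞)`: the tails of a function in `L^2_α` decay like
`r ^ (-(α - 1) / 2)`. -/
lemma tail_of_memLp (hα : 1 < α) {V : ℝ → ℝ} (hV : MemLp V 2 (weightMeasure α)) {r : ℝ}
    (hr : 0 < r) : IntegrableOn V (Ioi r) ∧
      ∫ t in Ioi r, |V t| ≤
        (eLpNorm V 2 (weightMeasure α)).toReal * (α - 1) ^ (-(1 / 2 : ℝ)) *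
          r ^ (-(α - 1) / 2) := by
  set g : ℝ → ℝ := (Ioi r).indicator fun s => s ^ (-α) with hg
  have hgm : Measurable g :=
    Measurable.indicator (by fun_prop) measurableSet_Ioi
  have hsub : Ioi r ⊆ Ioi 0 := Ioi_subset_Ioi hr.le
  have hmul : ∀ f : ℝ → ℝ, EqOn (fun s => f s * g s * s ^ α) ((Ioi r).indicator f) (Ioi 0) := by
    intro f s hs
    by_cases h : s ∈ Ioi r
    · simp only [hg, indicator_of_mem h]
      rw [mul_assoc, ← Real.rpow_add hs]
      simp
    · simp [hg, indicator_of_notMem h]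
  have hsq : EqOn (fun s => g s ^ 2 * s ^ α) ((Ioi r).indicator fun s => s ^ (-α)) (Ioi 0) := by
    intro s hs
    simp only [sq, hmul g hs]
    by_cases h : s ∈ Ioi r <;> simp [hg, h]
  have hg2 : MemLp g 2 (weightMeasure α) := by
    rw [memLp_two_iff_integrable_sq hgm.aestronglyMeasurable, integrable_weightMeasure_iff,
      integrableOn_congr_fun hsq measurableSet_Ioi]
    exact ((integrableOn_Ioi_rpow_of_lt (by linarith) hr).integrable_indicator
      measurableSet_Ioi).integrableOn
  have hsqi : ∫ s, g s ^ 2 ∂weightMeasure α = r ^ (1 - α) / (α - 1) := by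
    rw [integral_weightMeasure, setIntegral_congr_fun measurableSet_Ioi hsq,
      setIntegral_indicator measurableSet_Ioi, inter_eq_right.2 hsub,
      integral_Ioi_rpow_of_lt (by linarith) hr, show -α + 1 = -(α - 1) by ring,
      show 1 - α = -(α - 1) by ring, neg_div_neg_eq]
  constructor
  · have h1 := hV.integrable_mul hg2
    rw [integrable_weightMeasure_iff] at h1
    have h2 := (integrableOn_congr_fun (hmul V) measurableSet_Ioi).1 h1
    have h3 := (integrable_indicator_iff measurableSet_Ioi).1 h2
    rwa [IntegrableOn, Measure.restrict_restrict measurableSet_Ioi, inter_eq_left.2 hsub] at h3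
  · have h1 := integral_mul_le_Lp_mul_Lq_of_nonneg (μ := weightMeasure α)
      (Real.HolderConjugate.two_two) (f := fun s => |V s|) (g := g)
      (Eventually.of_forall fun s => abs_nonneg _)
      (Eventually.of_forall fun s => indicator_nonneg
        (fun s hs => Real.rpow_nonneg (hr.trans hs).le _) s)
      (by simpa using hV.norm) (by simpa using hg2)
    have h2 : (eLpNorm V 2 (weightMeasure α)).toReal =
        (∫ s, |V s| ^ (2 : ℝ) ∂weightMeasure α) ^ (1 / 2 : ℝ) := by
      rw [hV.eLpNorm_eq_integral_rpow_norm (by norm_num) (by norm_num),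
        ENNReal.toReal_ofReal (by positivity)]
      simp
    rw [← h2, integral_weightMeasure, setIntegral_congr_fun measurableSet_Ioi (hmul _),
      setIntegral_indicator measurableSet_Ioi, inter_eq_right.2 hsub] at h1
    refine h1.trans (le_of_eq ?_)
    simp only [Real.rpow_two] at hsqi ⊢
    rw [hsqi, mul_assoc, Real.div_rpow (by positivity) (by linarith), ← Real.rpow_mul hr.le,
      Real.rpow_neg (by linarith : (0 : ℝ) ≤ α - 1), show (1 - α) * (1 / 2) = -(α - 1) / 2 by ring]
    ring

end Weight

/-! ### Functions in `𝒟^{m,2}_∞(α)` as iterated integrals -/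

/-- The iterated primitives of `V` that vanish at infinity: `tailIter V i` is the function whose
`i`-th derivative is `V`. -/
noncomputable def tailIter (V : ℝ → ℝ) : ℕ → ℝ → ℝ
  | 0 => V
  | i + 1 => fun r => -∫ t in Ioi r, tailIter V i t

section Tail

variable {α : ℝ}

/-- The `i`-th primitive of an `L^2_α` function is `O(r ^ (i - (α + 1) / 2))`, with a constant
proportional to the `L^2_α` norm. -/
lemma exists_tailIter_bound (hα : 1 < α) (i : ℕ) (hi : 2 * (i : ℝ) + 1 < α) :
    ∃ K : ℝ, ∀ V : ℝ → ℝ, MemLp V 2 (weightMeasure α) →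
      ContinuousOn (tailIter V (i + 1)) (Ioi 0) ∧
      ∀ r : ℝ, 0 < r → |tailIter V (i + 1) r| ≤
        K * (eLpNorm V 2 (weightMeasure α)).toReal * r ^ ((i : ℝ) + 1 - (α + 1) / 2) := by
  induction i with
  | zero =>
    refine ⟨(α - 1) ^ (-(1 / 2 : ℝ)), fun V hV =>
      ⟨(acLoc_neg_tail fun r hr => (tail_of_memLp hα hV hr).1).continuousOn, fun r hr => ?_⟩⟩
    change |-∫ t in Ioi r, V t| ≤ _
    rw [abs_neg]
    refine (abs_integral_le_integral_abs).trans ((tail_of_memLp hα hV hr).2.trans (le_of_eq ?_))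
    rw [mul_comm (_ ^ _), Nat.cast_zero]
    congr 2
    ring
  | succ i ih =>
    push_cast at hi
    obtain ⟨K, hK⟩ := ih (by linarith)
    have hp : (i : ℝ) + 1 - (α + 1) / 2 < -1 := by linarith
    refine ⟨K * (-1 / ((i : ℝ) + 1 - (α + 1) / 2 + 1)), fun V hV => ?_⟩
    obtain ⟨hc, hb⟩ := hK V hV
    have hi' : ∀ r : ℝ, 0 < r → IntegrableOn (tailIter V (i + 1)) (Ioi r) := fun r hr =>
      PowBound.integrableOn_Ioi ⟨_, hb⟩ hc hp hr
    refine ⟨(acLoc_neg_tail hi').continuousOn, fun r hr => ?_⟩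
    change |-∫ t in Ioi r, tailIter V (i + 1) t| ≤ _
    rw [abs_neg]
    refine (PowBound.abs_tail_le hb hp hr).trans (le_of_eq ?_)
    push_cast
    rw [show (i : ℝ) + 1 + 1 - (α + 1) / 2 = (i : ℝ) + 1 - (α + 1) / 2 + 1 by ring]
    ring

lemma powBound_tailIter (hα : 1 < α) {V : ℝ → ℝ} (hV : MemLp V 2 (weightMeasure α)) {i : ℕ}
    (hi : 2 * (i : ℝ) + 1 < α) :
    PowBound ((i : ℝ) + 1 - (α + 1) / 2) (tailIter V (i + 1)) := by
  obtain ⟨K, hK⟩ := exists_tailIter_bound hα i hi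
  exact ⟨_, (hK V hV).2⟩

lemma integrableOn_tailIter (hα : 1 < α) {V : ℝ → ℝ} (hV : MemLp V 2 (weightMeasure α)) {i : ℕ}
    (hi : 2 * (i : ℝ) + 1 < α) {r : ℝ} (hr : 0 < r) : IntegrableOn (tailIter V i) (Ioi r) := by
  match i, hi with
  | 0, _ => exact (tail_of_memLp hα hV hr).1
  | i + 1, hi =>
    push_cast at hi
    obtain ⟨K, hK⟩ := exists_tailIter_bound hα i (by linarith)
    exact PowBound.integrableOn_Ioi ⟨_, (hK V hV).2⟩ (hK V hV).1 (by linarith) hr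

lemma acLoc_tailIter (hα : 1 < α) {V : ℝ → ℝ} (hV : MemLp V 2 (weightMeasure α)) {i : ℕ}
    (hi : 2 * (i : ℝ) + 1 < α) : ACLoc (tailIter V (i + 1)) :=
  acLoc_neg_tail fun _ hr => integrableOn_tailIter hα hV hi hr

lemma hasDerivAt_tailIter (hα : 1 < α) {V : ℝ → ℝ} (hV : MemLp V 2 (weightMeasure α)) {i : ℕ}
    (hi : 2 * ((i + 1 : ℕ) : ℝ) + 1 < α) {r : ℝ} (hr : 0 < r) :
    HasDerivAt (tailIter V (i + 2)) (tailIter V (i + 1) r) r := by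
  have hi' : 2 * (i : ℝ) + 1 < α := by push_cast at hi; linarith
  have := (hasDerivAt_tail (acLoc_tailIter hα hV hi').continuousOn
    (fun _ hr => integrableOn_tailIter hα hV hi hr) hr).fun_neg
  rw [neg_neg] at this
  exact this

lemma tailIter_sub (hα : 1 < α) {V W : ℝ → ℝ} (hV : MemLp V 2 (weightMeasure α))
    (hW : MemLp W 2 (weightMeasure α)) (i : ℕ) (hi : 2 * (i : ℝ) < α + 1) {r : ℝ} (hr : 0 < r) :
    tailIter (V - W) i r = tailIter V i r - tailIter W i r := by
  induction i generalizing r with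
  | zero => rfl
  | succ i ih =>
    push_cast at hi
    change -∫ t in Ioi r, tailIter (V - W) i t =
      -(∫ t in Ioi r, tailIter V i t) - -∫ t in Ioi r, tailIter W i t
    rw [setIntegral_congr_fun measurableSet_Ioi fun t ht => ih (by linarith) (hr.trans ht),
      integral_sub (integrableOn_tailIter hα hV (by linarith) hr)
        (integrableOn_tailIter hα hW (by linarith) hr)]
    ring

end Tail

lemma contDiffOn_one_iteratedDeriv {n k : ℕ} {U : ℝ → ℝ} (hU : ContDiffOn ℝ n U (Ioi 0))
    (hk : k < n) : ContDiffOn ℝ 1 (iteratedDeriv k U) (Ioi 0) := by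
  have hd : ∀ r : ℝ, 0 < r → HasDerivAt (iteratedDeriv k U) (iteratedDeriv (k + 1) U r) r := by
    intro r hr
    have h1 := hU.differentiableOn_iteratedDerivWithin (m := k) (by exact_mod_cast hk)
      isOpen_Ioi.uniqueDiffOn
    have h2 := h1.congr (fun x hx => (iteratedDerivWithin_of_isOpen isOpen_Ioi hx).symm)
    rw [iteratedDeriv_succ]
    exact (h2.differentiableAt (Ioi_mem_nhds hr)).hasDerivAt
  have hc := hU.continuousOn_iteratedDerivWithin (m := k + 1) (by exact_mod_cast hk)
      isOpen_Ioi.uniqueDiffOn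
  have hc2 := hc.congr (fun x hx => (iteratedDerivWithin_of_isOpen isOpen_Ioi hx).symm)
  have := contDiffOn_succ_of_hasDerivAt (n := 0) hd
    (by rw [Nat.cast_zero]; exact contDiffOn_zero.2 hc2)
  simpa using this

namespace MemD0

variable {m : ℕ} {α : ℝ} {U W : ℝ → ℝ}

lemma acLoc_iteratedDeriv (hU : MemD0 m α U) {k : ℕ} (hk : k < m) :
    ACLoc (iteratedDeriv k U) := by
  rcases eq_or_lt_of_le (Nat.le_sub_one_of_lt hk) with rfl | h
  · exact hU.acLoc.2
  · exact ACLoc.of_contDiffOn (contDiffOn_one_iteratedDeriv hU.acLoc.1 h)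

/-- Repeated integration from infinity recovers `U` from `U^{(m)}`. -/
lemma eq_tailIter (hα : 0 < α - 2 * (m : ℝ) + 1) (hm : 1 ≤ m) (hU : MemD0 m α U) :
    EqOn U (tailIter (iteratedDeriv m U) m) (Ioi 0) := by
  have hm' : (1 : ℝ) ≤ m := by exact_mod_cast hm
  have key : ∀ i ≤ m, EqOn (iteratedDeriv (m - i) U) (tailIter (iteratedDeriv m U) i) (Ioi 0) := by
    intro i
    induction i with
    | zero => intro _ r _; rfl
    | succ i ih =>
      intro him r hr
      have hi' : ((i : ℝ) + 1) ≤ m := by exact_mod_cast him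
      have e := ih (by omega)
      have hsucc : deriv (iteratedDeriv (m - (i + 1)) U) = iteratedDeriv (m - i) U := by
        rw [← iteratedDeriv_succ]
        congr 1
        omega
      have hint : ∀ r : ℝ, 0 < r →
          IntegrableOn (deriv (iteratedDeriv (m - (i + 1)) U)) (Ioi r) := by
        intro r hr
        rw [hsucc, integrableOn_congr_fun (e.mono (Ioi_subset_Ioi hr.le)) measurableSet_Ioi]
        exact integrableOn_tailIter (by linarith) hU.memLp (by linarith) hr
      rw [(hU.acLoc_iteratedDeriv (by omega)).eq_neg_tail (hU.tendsto_zero _ (by omega)) hint hr,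
        hsucc, setIntegral_congr_fun measurableSet_Ioi
          (e.mono (Ioi_subset_Ioi (le_of_lt hr)))]
      rfl
  simpa using key m le_rfl

lemma iteratedDeriv_sub_ae (hm : 1 ≤ m) (hU : MemD0 m α U) (hW : MemD0 m α W) :
    iteratedDeriv m (U - W) =ᵐ[weightMeasure α] iteratedDeriv m U - iteratedDeriv m W := by
  have e : EqOn (iteratedDeriv (m - 1) (U - W))
      (iteratedDeriv (m - 1) U - iteratedDeriv (m - 1) W) (Ioi 0) := fun r hr =>
    iteratedDeriv_sub (hU.acLoc.1.contDiffAt (Ioi_mem_nhds hr))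
      (hW.acLoc.1.contDiffAt (Ioi_mem_nhds hr))
  refine ae_weightMeasure_iff.2 ?_
  filter_upwards [hU.acLoc.2.ae_differentiableAt, hW.acLoc.2.ae_differentiableAt] with r h1 h2 hr
  have hs : ∀ f : ℝ → ℝ, iteratedDeriv m f = deriv (iteratedDeriv (m - 1) f) := fun f => by
    rw [← iteratedDeriv_succ, Nat.sub_add_cancel hm]
  rw [Pi.sub_apply, hs, hs, hs, e.deriv isOpen_Ioi hr, deriv_sub (h1 hr) (h2 hr)]

end MemD0

lemma MemD0.memD {m : ℕ} {α : ℝ} {U : ℝ → ℝ} (hU : MemD0 m α U) : MemD m α U := by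
  refine ⟨fun _ => U, fun _ => hU, ?_, fun r _ => tendsto_const_nhds⟩
  have : dirichletNorm m α (U - U) = 0 := by
    rw [sub_self, dirichletNorm, show (0 : ℝ → ℝ) = fun _ => 0 from rfl]
    have : iteratedDeriv m (fun _ : ℝ => (0 : ℝ)) = 0 := by
      ext x
      simp
    rw [this, eLpNorm_zero]
  simp only [this]
  exact tendsto_const_nhds

/-- Every element of the completion is the `m`-th primitive of an `L^2_α` function: the `m`-th
derivatives of a Cauchy sequence converge in `L^2_α`, and the `m`-th primitive at a point depends
continuously on its argument in `L^2_α`. -/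
lemma MemD.exists_eq_tailIter {m : ℕ} {α : ℝ} {u : ℝ → ℝ} (hα : 0 < α - 2 * (m : ℝ) + 1)
    (hm : 1 ≤ m) (hu : MemD m α u) :
    ∃ V : ℝ → ℝ, MemLp V 2 (weightMeasure α) ∧ EqOn u (tailIter V m) (Ioi 0) := by
  obtain ⟨U, hU, hcau, hlim⟩ := hu
  have hm' : (1 : ℝ) ≤ m := by exact_mod_cast hm
  set f : ℕ → Lp ℝ 2 (weightMeasure α) := fun n => (hU n).memLp.toLp _ with hf
  have hfc : CauchySeq f := by
    rw [Lp.cauchySeq_Lp_iff_cauchySeq_eLpNorm]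
    refine hcau.congr fun p => ?_
    refine eLpNorm_congr_ae (((hU p.1).iteratedDeriv_sub_ae hm (hU p.2)).trans ?_)
    exact ((hU p.1).memLp.coeFn_toLp.sub (hU p.2).memLp.coeFn_toLp).symm
  obtain ⟨L, hL⟩ := cauchySeq_tendsto_of_complete hfc
  refine ⟨L, Lp.memLp L, fun r hr => ?_⟩
  have h1 : Tendsto (fun n => eLpNorm (iteratedDeriv m (U n) - ⇑L) 2 (weightMeasure α)) atTop
      (𝓝 0) := by
    refine ((Lp.tendsto_Lp_iff_tendsto_eLpNorm' f L).1 hL).congr fun n => ?_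
    exact eLpNorm_congr_ae ((hU n).memLp.coeFn_toLp.sub (EventuallyEq.refl _ _))
  have h2 : Tendsto (fun n => (eLpNorm (iteratedDeriv m (U n) - ⇑L) 2 (weightMeasure α)).toReal)
      atTop (𝓝 0) := by
    have := (ENNReal.tendsto_toReal ENNReal.zero_ne_top).comp h1
    rwa [ENNReal.toReal_zero] at this
  obtain ⟨k, rfl⟩ : ∃ k, m = k + 1 := ⟨m - 1, by omega⟩
  push_cast at hα
  have hα1 : 1 < α := by push_cast at hm'; linarith
  obtain ⟨K, hK⟩ := exists_tailIter_bound hα1 k (by linarith)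
  refine tendsto_nhds_unique (hlim r hr) ?_
  rw [tendsto_iff_norm_sub_tendsto_zero]
  refine squeeze_zero (fun _ => norm_nonneg _) (fun n => ?_)
    (g := fun n => K * (eLpNorm (iteratedDeriv (k + 1) (U n) - ⇑L) 2 (weightMeasure α)).toReal *
      r ^ ((k : ℝ) + 1 - (α + 1) / 2)) ?_
  · have h3 := (hK _ ((hU n).memLp.sub (Lp.memLp L))).2 r hr
    rwa [tailIter_sub hα1 (hU n).memLp (Lp.memLp L) _ (by push_cast; linarith) hr,
      ← (hU n).eq_tailIter (by push_cast; linarith) hm hr] at h3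
  · simpa using (h2.const_mul K).mul_const (r ^ ((k : ℝ) + 1 - (α + 1) / 2))

/-! ### Comparing radial gradients and ordinary derivatives -/

/-- If `A` is a combination of the functions `r ^ (j - k) B_j`, `j ≤ k`, and `B_j` is up to a
multiple of `B_j / r` differentiated into `B_{j+1}`, then `A' + κ A / r` is a combination of the
functions `r ^ (j - k - 1) B_j`, `j ≤ k + 1`. -/
lemma exists_coeff_succ {A : ℝ → ℝ} {B : ℕ → ℝ → ℝ} (κ' : ℕ → ℝ) {c : ℕ → ℝ} {k : ℕ}
    (hA : ∀ r : ℝ, 0 < r → A r = ∑ j ∈ Finset.range (k + 1), c j * (r ^ ((j : ℝ) - k) * B j r))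
    (κ : ℝ) :
    ∃ c' : ℕ → ℝ, ∀ r : ℝ, 0 < r →
      (∀ j ≤ k, HasDerivAt (B j) (B (j + 1) r - κ' j / r * B j r) r) →
      deriv A r + κ / r * A r =
        ∑ j ∈ Finset.range (k + 2), c' j * (r ^ ((j : ℝ) - (k + 1 : ℕ)) * B j r) := by
  refine ⟨fun j => (if j ≤ k then c j * ((j : ℝ) - k - κ' j + κ) else 0) +
    (if j = 0 then 0 else c (j - 1)), fun r hr hB => ?_⟩
  have hd : HasDerivAt A (∑ j ∈ Finset.range (k + 1),
      c j * (((j : ℝ) - k) * r ^ ((j : ℝ) - k - 1) * B j r +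
        r ^ ((j : ℝ) - k) * (B (j + 1) r - κ' j / r * B j r))) r := by
    have h1 : HasDerivAt
        (fun r => ∑ j ∈ Finset.range (k + 1), c j * (r ^ ((j : ℝ) - k) * B j r)) _ r :=
      HasDerivAt.fun_sum fun j hj =>
        (((Real.hasDerivAt_rpow_const (x := r) (p := (j : ℝ) - k) (Or.inl hr.ne')).fun_mul
          (hB j (Nat.lt_succ_iff.1 (Finset.mem_range.1 hj)))).const_mul (c j))
    refine h1.congr_of_eventuallyEq ?_
    filter_upwards [Ioi_mem_nhds hr] with s hs using hA s hs
  rw [hd.deriv, hA r hr, Finset.mul_sum, ← Finset.sum_add_distrib]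
  simp only [add_mul (ite _ _ _), Finset.sum_add_distrib (s := Finset.range (k + 2))]
  rw [Finset.sum_range_succ (fun j => (if j ≤ k then _ else _) * _),
    Finset.sum_range_succ' (fun j => (if j = 0 then _ else _) * _)]
  simp only [if_neg (show ¬ k + 1 ≤ k by omega), if_true, zero_mul, add_zero,
    if_neg (Nat.succ_ne_zero _), Nat.add_sub_cancel]
  rw [← Finset.sum_add_distrib]
  refine Finset.sum_congr rfl fun j hj => ?_
  rw [if_pos (Nat.lt_succ_iff.1 (Finset.mem_range.1 hj))]
  have e1 : r ^ ((j : ℝ) - k) = r ^ ((j : ℝ) - k - 1) * r := by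
    rw [← Real.rpow_add_one hr.ne']
    congr 1
    ring
  have e2 : (j : ℝ) - (k + 1 : ℕ) = (j : ℝ) - k - 1 := by push_cast; ring
  have e3 : ((j + 1 : ℕ) : ℝ) - (k + 1 : ℕ) = (j : ℝ) - k := by push_cast; ring
  rw [e2, e3, e1]
  field_simp
  ring

/-- Radial gradients and ordinary derivatives of order `k` (and, more generally, any two sequences
`A_k`, `B_k` generated by operators `d/dr + κ_k / r` from the same function) are combinations of
the functions `r ^ (j - k) B_j`, `j ≤ k`, with constant coefficients. -/
lemma exists_coeff {A B : ℕ → ℝ → ℝ} {κ κ' : ℕ → ℝ} {n : ℕ} (h0 : EqOn (A 0) (B 0) (Ioi 0))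
    (hB : ∀ j < n, ∀ r : ℝ, 0 < r → HasDerivAt (B j) (B (j + 1) r - κ' j / r * B j r) r)
    (hA : ∀ k < n, ∀ r : ℝ, 0 < r → A (k + 1) r = deriv (A k) r + κ k / r * A k r) :
    ∀ k ≤ n, ∃ c : ℕ → ℝ, ∀ r : ℝ, 0 < r →
      A k r = ∑ j ∈ Finset.range (k + 1), c j * (r ^ ((j : ℝ) - k) * B j r) := by
  intro k
  induction k with
  | zero => exact fun _ => ⟨fun _ => 1, fun r hr => by simp [h0 hr]⟩
  | succ k ih =>
    intro hk
    obtain ⟨c, hc⟩ := ih (by omega)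
    obtain ⟨c', hc'⟩ := exists_coeff_succ κ' hc (κ k)
    refine ⟨c', fun r hr => ?_⟩
    rw [hA k (by omega) r hr, hc' r hr fun j hj => hB j (by omega) r hr]

lemma PowBound.of_coeff {A : ℝ → ℝ} {B : ℕ → ℝ → ℝ} {c : ℕ → ℝ} {k : ℕ} {p : ℝ}
    (hA : ∀ r : ℝ, 0 < r → A r = ∑ j ∈ Finset.range (k + 1), c j * (r ^ ((j : ℝ) - k) * B j r))
    (hB : ∀ j ≤ k, PowBound (p - j) (B j)) : PowBound (p - k) A := by
  refine PowBound.congr (PowBound.sum (Finset.range (k + 1)) fun j hj => ?_) hA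
  exact (((PowBound.rpow _).mul
    (hB j (Nat.lt_succ_iff.1 (Finset.mem_range.1 hj)))).const_mul (c j)).cast_exp (by ring)

lemma ACLoc.of_coeff {A : ℝ → ℝ} {B : ℕ → ℝ → ℝ} {c : ℕ → ℝ} {k : ℕ}
    (hA : ∀ r : ℝ, 0 < r → A r = ∑ j ∈ Finset.range (k + 1), c j * (r ^ ((j : ℝ) - k) * B j r))
    (hB : ∀ j ≤ k, ACLoc (B j)) : ACLoc A := by
  refine ACLoc.congr (ACLoc.sum (Finset.range (k + 1)) fun j hj => ?_) hA
  exact ((ACLoc.rpow _).mul (hB j (Nat.lt_succ_iff.1 (Finset.mem_range.1 hj)))).const_mul (c j)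

section MemD

variable {m : ℕ} {α : ℝ} {u : ℝ → ℝ}

/-- The radial gradients of order `k < m` of a function in `𝒟^{m,2}_∞(α)` are locally absolutely
continuous and `O(r ^ (-(α - 2m + 1)/2 - k))`; the one of order `m` is, up to a multiple of an
`L^2_α` function, continuous and bounded in the same way. -/
lemma MemD.chain_spec (hα : 0 < α - 2 * (m : ℝ) + 1) (hm : 1 ≤ m) (hu : MemD m α u) :
    (∀ k < m, ACLoc (chain α u k) ∧ PowBound (-(α - 2 * m + 1) / 2 - k) (chain α u k)) ∧
    ∃ (V R : ℝ → ℝ) (c : ℝ), MemLp V 2 (weightMeasure α) ∧ ContinuousOn R (Ioi 0) ∧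
      PowBound (-(α - 2 * m + 1) / 2 - m) R ∧
      ∀ᵐ r : ℝ, 0 < r → chain α u m r = R r + c * V r := by
  obtain ⟨V, hV, e⟩ := hu.exists_eq_tailIter hα hm
  have hm' : (1 : ℝ) ≤ m := by exact_mod_cast hm
  have hα1 : 1 < α := by linarith
  obtain ⟨n, rfl⟩ : ∃ n, m = n + 1 := ⟨m - 1, by omega⟩
  have hi : ∀ i ≤ n, 2 * (i : ℝ) + 1 < α := fun i hi => by
    have : (i : ℝ) ≤ n := by exact_mod_cast hi
    push_cast at hα
    linarith
  set B : ℕ → ℝ → ℝ := fun j => tailIter V (n + 1 - j) with hBdef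
  have hBeq : ∀ j ≤ n, B j = tailIter V (n - j + 1) := fun j hj => by
    simp only [hBdef]
    congr 1
    omega
  have hBac : ∀ j ≤ n, ACLoc (B j) := fun j hj => by
    rw [hBeq j hj]
    exact acLoc_tailIter hα1 hV (hi _ (by omega))
  have hBp : ∀ j ≤ n, PowBound (-(α - 2 * (n + 1 : ℕ) + 1) / 2 - j) (B j) := fun j hj => by
    rw [hBeq j hj]
    refine (powBound_tailIter hα1 hV (hi _ (by omega))).cast_exp ?_
    push_cast [Nat.cast_sub hj]
    ring
  have hBd : ∀ j < n, ∀ r : ℝ, 0 < r → HasDerivAt (B j) (B (j + 1) r - (0 : ℝ) / r * B j r) r := by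
    intro j hj r hr
    obtain ⟨i, rfl⟩ : ∃ i, n = j + 1 + i := ⟨n - (j + 1), by omega⟩
    rw [hBeq j (by omega), hBeq (j + 1) (by omega), show j + 1 + i - j + 1 = i + 2 by omega,
      show j + 1 + i - (j + 1) + 1 = i + 1 by omega, zero_div, zero_mul, sub_zero]
    exact hasDerivAt_tailIter hα1 hV (hi _ (by omega)) hr
  have hc := exists_coeff (A := chain α u) (B := B) (κ := chainCoeff α) (κ' := fun _ => 0)
    (n := n) e hBd (fun k _ r _ => chain_succ α u k r)
  refine ⟨fun k hk => ?_, ?_⟩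
  · obtain ⟨c, hc⟩ := hc k (by omega)
    exact ⟨ACLoc.of_coeff hc fun j hj => hBac j (by omega),
      PowBound.of_coeff hc fun j hj => hBp j (by omega)⟩
  · obtain ⟨c, hc⟩ := hc n le_rfl
    obtain ⟨c', hc'⟩ := exists_coeff_succ (fun _ => 0) hc (chainCoeff α n)
    refine ⟨V, fun r => ∑ j ∈ Finset.range (n + 1), c' j * (r ^ ((j : ℝ) - (n + 1 : ℕ)) * B j r),
      c' (n + 1), hV, ?_, ?_, ?_⟩
    · refine continuousOn_finsetSum _ fun j hj => continuousOn_const.mul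
        ((continuousOn_rpow _).mul
          (hBac j (Nat.lt_succ_iff.1 (Finset.mem_range.1 hj))).continuousOn)
    · refine PowBound.sum _ fun j hj => ?_
      exact (((PowBound.rpow _).mul
        (hBp j (Nat.lt_succ_iff.1 (Finset.mem_range.1 hj)))).const_mul (c' j)).cast_exp (by ring)
    · filter_upwards [ae_hasDerivAt_neg_tail fun r hr => (tail_of_memLp hα1 hV hr).1] with r hr h0
      rw [chain_succ, hc' r h0, Finset.sum_range_succ, sub_self, Real.rpow_zero, one_mul]
      · simp [hBdef, tailIter]
      · intro j hj
        rcases hj.lt_or_eq with h | rfl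
        · exact hBd j h r h0
        · simpa [hBdef, tailIter] using hr h0

/-- The pairing of `∇^m_α u` with a function that is square integrable by virtue of power bounds
converges absolutely. -/
lemma MemD.integrableOn_chain_mul (hα : 0 < α - 2 * (m : ℝ) + 1) (hm : 1 ≤ m) (hu : MemD m α u)
    {w : ℝ → ℝ} {p q : ℝ} (hw : ContinuousOn w (Ioi 0)) (h1 : PowBound p w) (h2 : PowBound q w)
    (hp : -1 < 2 * p + α) (hq : 2 * q + α < -1) :
    IntegrableOn (fun r => chain α u m r * w r * r ^ α) (Ioi 0) := by
  obtain ⟨-, V, R, c, hV, hR, hRp, hae⟩ := hu.chain_spec hα hm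
  have i1 := integrable_weightMeasure_iff.1 (hV.integrable_mul (memLp_of_powBound hw h1 h2 hp hq))
  have i2 : IntegrableOn (fun r => R r * w r * r ^ α) (Ioi 0) :=
    PowBound.integrableOn_Ioi_zero ((hRp.mul h1).mul (PowBound.rpow α))
      ((hRp.mul h2).mul (PowBound.rpow α)) ((hR.mul hw).mul (continuousOn_rpow α))
      (by linarith) (by linarith)
  refine (i2.add (i1.const_mul c)).congr ?_
  rw [EventuallyEq, ae_restrict_iff' measurableSet_Ioi]
  filter_upwards [hae] with r hr h0
  rw [hr h0]
  simp only [Pi.add_apply, Pi.mul_apply]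
  ring

end MemD

/-- Iterates of `greenInt` on functions with suitable decay at both ends belong to the energy
space. -/
lemma memD0_iterate_greenInt {m : ℕ} {α β₁ β₂ : ℝ} {g : ℝ → ℝ} (hm : 1 ≤ m)
    (hc : ContinuousOn g (Ioi 0)) (h1 : PowBound (-β₁) g) (h2 : PowBound (-β₂) g)
    (hβ₁ : 2 * (m : ℝ) < β₁) (hβ₁' : β₁ < (α + 2 * m + 1) / 2)
    (hβ₂' : (α + 2 * m + 1) / 2 < β₂) (hβ₂ : β₂ < α + 1) :
    MemD0 m α ((greenInt α)^[m] g) := by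
  have s1 := chain_iterate_greenInt (α := α) hc h1 (by linarith) m hβ₁
  have s2 := chain_iterate_greenInt (α := α) hc h2 hβ₂ m (by linarith)
  have hcd := (iterate_greenInt (α := α) hc h1 (by linarith) m hβ₁).1
  set v := (greenInt α)^[m] g
  have hco : ∀ k ≤ m, ∃ c : ℕ → ℝ, ∀ r : ℝ, 0 < r → iteratedDeriv k v r =
      ∑ j ∈ Finset.range (k + 1), c j * (r ^ ((j : ℝ) - k) * chain α v j r) := by
    refine exists_coeff (A := fun k => iteratedDeriv k v) (B := chain α v) (κ := fun _ => 0)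
      (κ' := chainCoeff α) (n := m) (fun r _ => by simp [chain_zero]) ?_ ?_
    · intro j hj r hr
      rw [chain_succ, add_sub_cancel_right]
      exact (((s1.2.1 j (by omega)).differentiableOn (by simp)).differentiableAt
        (Ioi_mem_nhds hr)).hasDerivAt
    · intro k _ r _
      simp [iteratedDeriv_succ]
  have hb : ∀ β, (∀ k ≤ 2 * m, ContinuousOn (chain α v k) (Ioi 0) ∧
      PowBound (2 * m - k - β) (chain α v k)) → ∀ k ≤ m,
      PowBound (2 * m - β - k) (iteratedDeriv k v) := by
    intro β h k hk
    obtain ⟨c, hc⟩ := hco k hk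
    exact PowBound.of_coeff hc fun j hj => (h j (by omega)).2.cast_exp (by ring)
  have hone : ∀ k < 2 * m, ContDiffOn ℝ 1 (iteratedDeriv k v) (Ioi 0) := fun k hk =>
    contDiffOn_one_iteratedDeriv hcd hk
  refine ⟨⟨hcd.of_le ?_, ACLoc.of_contDiffOn (hone _ (by omega))⟩, fun j hj => ?_, ?_⟩
  · exact_mod_cast (show m - 1 ≤ 2 * m by omega)
  · refine (hb β₁ s1.1 j hj.le).tendsto_atTop ?_
    have : (0 : ℝ) ≤ j := Nat.cast_nonneg j
    linarith
  · refine memLp_of_powBound (hone m (by omega)).continuousOn (hb β₁ s1.1 m le_rfl)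
      (hb β₂ s2.1 m le_rfl) (by linarith) (by linarith)

/-! ### Integration by parts -/

lemma ACLoc.integral_deriv_eq_zero {F : ℝ → ℝ} (hF : ACLoc F)
    (hi : IntegrableOn (deriv F) (Ioi 0)) (h0 : Tendsto F (𝓝[>] 0) (𝓝 0))
    (h1 : Tendsto F atTop (𝓝 0)) : ∫ r in Ioi (0 : ℝ), deriv F r = 0 := by
  have hc : Tendsto (fun b => ∫ r in Ioi b, deriv F r) (𝓝[>] 0)
      (𝓝 (∫ r in Ioi (0 : ℝ), deriv F r)) :=
    (hi.continuousOn_Ici_primitive_Ioi 0 self_mem_Ici).mono_left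
      (nhdsWithin_mono _ Ioi_subset_Ici_self)
  have h2 : Tendsto (fun b => ∫ r in Ioi b, deriv F r) (𝓝[>] 0) (𝓝 (-0)) := by
    refine h0.neg.congr' ?_
    filter_upwards [self_mem_nhdsWithin] with b hb
    rw [hF.eq_neg_tail h1 (fun r hr => hi.mono_set (Ioi_subset_Ioi hr.le)) hb, neg_neg]
  rw [neg_zero] at h2
  exact tendsto_nhds_unique hc h2

lemma chainCoeff_add (α : ℝ) {k l : ℕ} (h : Odd (k + l)) :
    chainCoeff α k + chainCoeff α l = α := by
  unfold chainCoeff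
  rw [Nat.odd_add] at h
  split_ifs with h1 h2 h2
  · exact absurd h1 (Nat.not_even_iff_odd.2 (h.2 h2))
  · simp
  · simp
  · exact absurd (h.1 (Nat.not_even_iff_odd.1 h1)) h2

/-- The factors `d/dr` and `-(d/dr + α / r)` are adjoint to each other in `L^2_α`. -/
lemma integral_chain_succ_mul {α : ℝ} {a b : ℝ → ℝ} {k l : ℕ} (hkl : Odd (k + l))
    (ha : ACLoc (chain α a k)) (hb : ACLoc (chain α b l))
    (i1 : IntegrableOn (fun r => chain α a (k + 1) r * chain α b l r * r ^ α) (Ioi 0))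
    (i2 : IntegrableOn (fun r => chain α a k r * chain α b (l + 1) r * r ^ α) (Ioi 0))
    (t0 : Tendsto (fun r => chain α a k r * chain α b l r * r ^ α) (𝓝[>] 0) (𝓝 0))
    (t1 : Tendsto (fun r => chain α a k r * chain α b l r * r ^ α) atTop (𝓝 0)) :
    ∫ r in Ioi (0 : ℝ), chain α a (k + 1) r * chain α b l r * r ^ α =
      -∫ r in Ioi (0 : ℝ), chain α a k r * chain α b (l + 1) r * r ^ α := by
  have hF : ACLoc fun r => chain α a k r * chain α b l r * r ^ α := (ha.mul hb).mul (ACLoc.rpow α)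
  have hd : (fun r => chain α a (k + 1) r * chain α b l r * r ^ α +
      chain α a k r * chain α b (l + 1) r * r ^ α) =ᵐ[volume.restrict (Ioi 0)]
      deriv fun r => chain α a k r * chain α b l r * r ^ α := by
    rw [EventuallyEq, ae_restrict_iff' measurableSet_Ioi]
    filter_upwards [ha.ae_differentiableAt, hb.ae_differentiableAt] with r h1 h2 hr
    have hr' : (0 : ℝ) < r := hr
    rw [(((h1 hr).hasDerivAt.fun_mul (h2 hr).hasDerivAt).fun_mul
      (Real.hasDerivAt_rpow_const (x := r) (p := α) (Or.inl hr'.ne'))).deriv, chain_succ,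
      chain_succ, Real.rpow_sub_one hr'.ne']
    have := chainCoeff_add α hkl
    obtain hk : chainCoeff α k = α - chainCoeff α l := by linarith
    rw [hk]
    field_simp
    ring
  have h := hF.integral_deriv_eq_zero ((i1.add i2).congr hd) t0 t1
  rw [← integral_congr_ae hd, integral_add i1 i2] at h
  linarith

/-- Transfer of `n` radial gradients from one factor to the other. The decay rates of `a` and the
two rates of `b` (one good near `0`, one good near `∞`) make every intermediate pairing converge
absolutely and every boundary term vanish. -/
lemma integral_chain_mul_transfer {α : ℝ} {a b : ℝ → ℝ} {m n : ℕ} {β₁ β₂ : ℝ} (hn : n ≤ 2 * m)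
    (ha : ∀ k < n, ACLoc (chain α a k) ∧ PowBound (-(α - 2 * m + 1) / 2 - k) (chain α a k))
    (hb : ∀ l < 2 * m, ACLoc (chain α b l))
    (hbc : ContinuousOn (chain α b (2 * m)) (Ioi 0))
    (hb1 : ∀ l ≤ 2 * m, PowBound (2 * m - l - β₁) (chain α b l))
    (hb2 : ∀ l ≤ 2 * m, PowBound (2 * m - l - β₂) (chain α b l))
    (hβ₁ : β₁ < (α + 2 * m + 1) / 2) (hβ₂ : (α + 2 * m + 1) / 2 < β₂)
    (hint : IntegrableOn (fun r => chain α a n r * chain α b (2 * m - n) r * r ^ α) (Ioi 0)) :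
    ∫ r in Ioi (0 : ℝ), chain α a n r * chain α b (2 * m - n) r * r ^ α =
      (-1) ^ n * ∫ r in Ioi (0 : ℝ), a r * chain α b (2 * m) r * r ^ α := by
  have hbc' : ∀ l ≤ 2 * m, ContinuousOn (chain α b l) (Ioi 0) := fun l hl => by
    rcases hl.lt_or_eq with h | rfl
    · exact (hb l h).continuousOn
    · exact hbc
  have hint' : ∀ k ≤ n,
      IntegrableOn (fun r => chain α a k r * chain α b (2 * m - k) r * r ^ α) (Ioi 0) := by
    intro k hk
    rcases hk.lt_or_eq with h | rfl
    · have hcast : ((2 * m - k : ℕ) : ℝ) = 2 * m - k := by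
        rw [Nat.cast_sub (by omega)]
        push_cast
        rfl
      refine PowBound.integrableOn_Ioi_zero
        (((ha k h).2.mul (hb1 (2 * m - k) (by omega))).mul (PowBound.rpow α))
        (((ha k h).2.mul (hb2 (2 * m - k) (by omega))).mul (PowBound.rpow α))
        (((ha k h).1.continuousOn.mul (hbc' _ (by omega))).mul (continuousOn_rpow α)) ?_ ?_ <;>
      · rw [hcast]
        linarith
    · exact hint
  have key : ∀ k ≤ n, ∫ r in Ioi (0 : ℝ), chain α a k r * chain α b (2 * m - k) r * r ^ α =
      (-1) ^ k * ∫ r in Ioi (0 : ℝ), a r * chain α b (2 * m) r * r ^ α := by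
    intro k
    induction k with
    | zero => intro _; simp [chain_zero]
    | succ k ih =>
      intro hk
      obtain ⟨l, hl⟩ : ∃ l, 2 * m = k + 1 + l := ⟨2 * m - (k + 1), by omega⟩
      have hlr : (2 * m : ℝ) = k + 1 + l := by exact_mod_cast hl
      have e1 : 2 * m - k = l + 1 := by omega
      have e2 : 2 * m - (k + 1) = l := by omega
      have i1 := hint' (k + 1) hk
      have i2 := hint' k (by omega)
      have ih' := ih (by omega)
      rw [e1] at i2 ih'
      rw [e2] at i1 ⊢
      have hodd : Odd (k + l) := by
        rw [← Nat.not_even_iff_odd, ← Nat.even_add_one, show k + l + 1 = 2 * m by omega]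
        exact even_two_mul m
      rw [integral_chain_succ_mul hodd (ha k (by omega)).1
        (hb l (by omega)) i1 i2 ?_ ?_, ih', pow_succ]
      · ring
      · refine PowBound.tendsto_zero (((ha k (by omega)).2.mul (hb1 l (by omega))).mul
          (PowBound.rpow α)) ?_
        linarith
      · refine PowBound.tendsto_atTop (((ha k (by omega)).2.mul (hb2 l (by omega))).mul
          (PowBound.rpow α)) ?_
        linarith
  exact key n le_rfl

lemma powBound_of_compactSupport {g : ℝ → ℝ} (hg : Continuous g) (hs : HasCompactSupport g)
    (hpos : tsupport g ⊆ Ioi 0) (p : ℝ) : PowBound p g := by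
  have hc : ContinuousOn (fun r => g r * r ^ (-p)) (tsupport g) :=
    hg.continuousOn.mul ((continuousOn_rpow (-p)).mono hpos)
  obtain ⟨C, hC⟩ := hs.isCompact.exists_bound_of_continuousOn hc
  refine ⟨max C 0, fun r hr => ?_⟩
  by_cases h : r ∈ tsupport g
  · have h1 := hC r h
    rw [Real.norm_eq_abs, abs_mul, abs_of_pos (Real.rpow_pos_of_pos hr _), Real.rpow_neg hr.le,
      ← div_eq_mul_inv, div_le_iff₀ (Real.rpow_pos_of_pos hr _)] at h1
    exact h1.trans (mul_le_mul_of_nonneg_right (le_max_left _ _) (Real.rpow_nonneg hr.le _))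
  · rw [image_eq_zero_of_notMem_tsupport h, abs_zero]
    exact mul_nonneg (le_max_right _ _) (Real.rpow_nonneg hr.le _)

/-! ### The nonlinearity -/

lemma critExp_sub_two {m : ℕ} {α : ℝ} (hα : 0 < α - 2 * (m : ℝ) + 1) :
    critExp m α - 2 = 4 * m / (α - 2 * m + 1) := by
  unfold critExp
  field_simp
  ring

lemma critExp_sub_two_pos {m : ℕ} {α : ℝ} (hm : 1 ≤ m) (hα : 0 < α - 2 * (m : ℝ) + 1) :
    0 < critExp m α - 2 := by
  have : (1 : ℝ) ≤ m := by exact_mod_cast hm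
  rw [critExp_sub_two hα]
  positivity

lemma hasDerivAt_abs_rpow_mul_self {p : ℝ} (hp : 0 < p) (x : ℝ) :
    HasDerivAt (fun x : ℝ => |x| ^ p * x) ((p + 1) * |x| ^ p) x := by
  rcases lt_trichotomy x 0 with h | rfl | h
  · have h1 : HasDerivAt (fun x : ℝ => (-x) ^ p * x)
        (-1 * p * (-x) ^ (p - 1) * x + (-x) ^ p * 1) x :=
      ((hasDerivAt_neg x).rpow_const (Or.inl (by linarith))).fun_mul (hasDerivAt_id x)
    have hx : (-x) ≠ 0 := by linarith
    have hx' : x ≠ 0 := h.ne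
    refine (h1.congr_of_eventuallyEq ?_).congr_deriv ?_
    · filter_upwards [Iio_mem_nhds h] with y hy
      rw [abs_of_neg hy]
    · rw [abs_of_neg h, Real.rpow_sub_one hx]
      field_simp
  · rw [hasDerivAt_iff_tendsto_slope]
    have h1 : Tendsto (fun y : ℝ => |y| ^ p) (𝓝[≠] 0) (𝓝 0) := by
      have h2 : ContinuousAt (fun y : ℝ => |y| ^ p) 0 :=
        (continuous_abs.continuousAt).rpow_const (Or.inr hp.le)
      have h3 := h2.tendsto
      simp only [abs_zero, Real.zero_rpow hp.ne'] at h3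
      exact h3.mono_left nhdsWithin_le_nhds
    simp only [abs_zero, Real.zero_rpow hp.ne', mul_zero]
    refine h1.congr' ?_
    filter_upwards [self_mem_nhdsWithin] with y hy
    have hy' : y ≠ 0 := hy
    simp [slope_def_field, hy']
  · have h1 : HasDerivAt (fun x : ℝ => x ^ p * x) (1 * p * x ^ (p - 1) * x + x ^ p * 1) x :=
      ((hasDerivAt_id x).rpow_const (Or.inl h.ne')).fun_mul (hasDerivAt_id x)
    refine (h1.congr_of_eventuallyEq ?_).congr_deriv ?_
    · filter_upwards [Ioi_mem_nhds h] with y hy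
      rw [abs_of_pos hy]
    · rw [abs_of_pos h, Real.rpow_sub_one h.ne']
      field_simp

lemma continuousOn_critNonlin {m : ℕ} {α : ℝ} {u : ℝ → ℝ} (hp : 0 < critExp m α - 2)
    (hu : ContinuousOn u (Ioi 0)) : ContinuousOn (critNonlin m α u) (Ioi 0) :=
  (hu.abs.rpow_const fun _ _ => Or.inr hp.le).mul hu

/-- The pointwise decay of functions in `𝒟^{m,2}_∞(α)` turns into the decay rate
`-(α + 2m + 1)/2` of the nonlinearity. -/
lemma powBound_critNonlin {m : ℕ} {α : ℝ} {u : ℝ → ℝ} (hm : 1 ≤ m)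
    (hα : 0 < α - 2 * (m : ℝ) + 1) (hu : PowBound (-(α - 2 * m + 1) / 2) u) :
    PowBound (-((α + 2 * m + 1) / 2)) (critNonlin m α u) := by
  have hp := critExp_sub_two_pos hm hα
  obtain ⟨C, hC0, hC⟩ := hu.exists_nonneg
  have h1 : PowBound (-(α - 2 * m + 1) / 2 * (critExp m α - 2))
      (fun r => |u r| ^ (critExp m α - 2)) := by
    refine ⟨C ^ (critExp m α - 2), fun r hr => ?_⟩
    rw [abs_of_nonneg (Real.rpow_nonneg (abs_nonneg _) _), Real.rpow_mul hr.le,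
      ← Real.mul_rpow hC0 (Real.rpow_nonneg hr.le _)]
    exact Real.rpow_le_rpow (abs_nonneg _) (hC r hr) hp.le
  refine (h1.mul hu).cast_exp ?_
  rw [critExp_sub_two hα]
  field_simp
  ring

/-! ### Representation of weak solutions -/

/-- A weak solution is the `m`-fold Green integral of its nonlinearity. Testing the equation with
`v = G^m g`, `G = greenInt α`, `g` smooth with compact support, and moving all derivatives onto
`v` on the left and off `G^m f` on the right gives `∫ u g r^α = ∫ (G^m f) g r^α`. -/
lemma IsWeakSolution.eq_iterate_greenInt {m : ℕ} {α : ℝ} {u : ℝ → ℝ} (hm : 1 ≤ m)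
    (hα : 0 < α - 2 * (m : ℝ) + 1) (hu : IsWeakSolution m α u) :
    EqOn u ((greenInt α)^[m] (critNonlin m α u)) (Ioi 0) := by
  obtain ⟨hD, hweak⟩ := hu
  have hm' : (1 : ℝ) ≤ m := by exact_mod_cast hm
  obtain ⟨hchain, -⟩ := hD.chain_spec hα hm
  have huc : ContinuousOn u (Ioi 0) := (hchain 0 (by omega)).1.continuousOn
  have hub : PowBound (-(α - 2 * m + 1) / 2) u := (hchain 0 (by omega)).2.cast_exp (by simp)
  have hfc := continuousOn_critNonlin (critExp_sub_two_pos hm hα) huc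
  have hfb := powBound_critNonlin hm hα hub
  obtain ⟨w1, w2, w3⟩ := chain_iterate_greenInt (α := α) hfc hfb (by linarith) m (by linarith)
  set f := critNonlin m α u
  set w := (greenInt α)^[m] f
  have hwc : ContinuousOn w (Ioi 0) := (w1 0 (by omega)).1
  have hdiff : ContinuousOn (fun r => (u r - w r) * r ^ α) (Ioi 0) :=
    (huc.sub hwc).mul (continuousOn_rpow α)
  have hae : ∀ᵐ r : ℝ, r ∈ Ioi (0 : ℝ) → (u r - w r) * r ^ α = 0 := by
    refine isOpen_Ioi.ae_eq_zero_of_integral_contDiff_smul_eq_zero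
      (hdiff.locallyIntegrableOn measurableSet_Ioi) fun g hg hgs hgp => ?_
    -- Rates on either side of the midpoint `(α + 2m + 1)/2` of the interval `(2m, α + 1)`.
    obtain ⟨β₁, b1, b1'⟩ := exists_between (show (2 * m : ℝ) < (α + 2 * m + 1) / 2 by linarith)
    obtain ⟨β₂, b2', b2⟩ := exists_between (show (α + 2 * m + 1) / 2 < α + 1 by linarith)
    have hgc : ContinuousOn g (Ioi 0) := hg.continuous.continuousOn
    have hgb := fun p => powBound_of_compactSupport hg.continuous hgs hgp p
    have hv := (memD0_iterate_greenInt hm hgc (hgb _) (hgb _) b1 b1' b2' b2).memD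
    obtain ⟨v1, v2, v3⟩ := chain_iterate_greenInt (α := α) hgc (hgb (-β₁)) (by linarith) m b1
    have v1' := (chain_iterate_greenInt (α := α) hgc (hgb (-β₂)) b2 m (by linarith)).1
    set v := (greenInt α)^[m] g
    have hvac : ∀ l < 2 * m, ACLoc (chain α v l) := fun l hl => ACLoc.of_contDiffOn (v2 l hl)
    have hvc : ContinuousOn (chain α v (2 * m)) (Ioi 0) := (v1 _ le_rfl).1
    have vint : ∀ h : ℝ → ℝ, ∫ r in Ioi (0 : ℝ), h r * chain α v (2 * m) r * r ^ α =
        (-1) ^ m * ∫ r in Ioi (0 : ℝ), h r * g r * r ^ α := fun h => by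
      rw [← integral_const_mul]
      refine setIntegral_congr_fun measurableSet_Ioi fun r hr => ?_
      simp only [v3 hr]
      ring
    have hsq : ((-1 : ℝ) ^ m) * (-1) ^ m = 1 := by
      rw [← mul_pow]
      simp
    have em : 2 * m - m = m := by omega
    have hleft := integral_chain_mul_transfer (n := m) (by omega) hchain hvac hvc
      (fun l hl => (v1 l hl).2) (fun l hl => (v1' l hl).2) b1' b2' (by
        rw [em]
        exact hD.integrableOn_chain_mul hα hm (v1 m (by omega)).1 (v1 m (by omega)).2
          (v1' m (by omega)).2 (by linarith) (by linarith))
    rw [em, vint, ← mul_assoc, hsq, one_mul] at hleft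
    have w2m : ∀ k ≤ 2 * m, PowBound (-(α - 2 * m + 1) / 2 - k) (chain α w k) := fun k hk =>
      (w1 k hk).2.cast_exp (by ring)
    have hright := integral_chain_mul_transfer (n := 2 * m) le_rfl
      (fun k hk => ⟨ACLoc.of_contDiffOn (w2 k hk), w2m k hk.le⟩) hvac hvc
      (fun l hl => (v1 l hl).2) (fun l hl => (v1' l hl).2) b1' b2' (by
        rw [Nat.sub_self]
        refine PowBound.integrableOn_Ioi_zero
          (((w2m _ le_rfl).mul (v1 0 (by omega)).2).mul (PowBound.rpow α))
          (((w2m _ le_rfl).mul (v1' 0 (by omega)).2).mul (PowBound.rpow α))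
          (((w1 _ le_rfl).1.mul (v1 0 (by omega)).1).mul (continuousOn_rpow α)) ?_ ?_ <;>
        · push_cast
          linarith)
    rw [Nat.sub_self, chain_zero, vint, (even_two_mul m).neg_one_pow, one_mul] at hright
    have hf : ∫ r in Ioi (0 : ℝ), chain α w (2 * m) r * v r * r ^ α =
        (-1) ^ m * ∫ r in Ioi (0 : ℝ), f r * v r * r ^ α := by
      rw [← integral_const_mul]
      refine setIntegral_congr_fun measurableSet_Ioi fun r hr => ?_
      simp only [w3 hr]
      ring
    rw [hf] at hright
    have hright' : ∫ r in Ioi (0 : ℝ), f r * v r * r ^ α =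
        ∫ r in Ioi (0 : ℝ), w r * g r * r ^ α :=
      mul_left_cancel₀ (pow_ne_zero m (by norm_num : (-1 : ℝ) ≠ 0)) hright
    have hw' := hweak v hv
    rw [← chain_eq_grad, ← chain_eq_grad, hleft, hright'] at hw'
    have hgi : ∀ h : ℝ → ℝ, ContinuousOn h (Ioi 0) → PowBound (-(α - 2 * m + 1) / 2) h →
        IntegrableOn (fun r => h r * g r * r ^ α) (Ioi 0) := fun h hc hb =>
      PowBound.integrableOn_Ioi_zero ((hb.mul (hgb (-β₁))).mul (PowBound.rpow α))
        ((hb.mul (hgb (-β₂))).mul (PowBound.rpow α)) ((hc.mul hgc).mul (continuousOn_rpow α))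
        (by linarith) (by linarith)
    have hsub : ∫ r in Ioi (0 : ℝ), (u r * g r * r ^ α - w r * g r * r ^ α) = 0 := by
      rw [integral_sub (hgi u huc hub) (hgi w hwc ((w2m 0 (by omega)).cast_exp (by simp))), hw',
        sub_self]
    rw [← hsub, ← setIntegral_eq_integral_of_forall_compl_eq_zero (s := Ioi 0)]
    · refine setIntegral_congr_fun measurableSet_Ioi fun r _ => ?_
      simp only [smul_eq_mul]
      ring
    · intro r hr
      rw [image_eq_zero_of_notMem_tsupport fun h => hr (hgp h), zero_smul]
  refine Measure.eqOn_open_of_ae_eq (μ := volume) ?_ isOpen_Ioi huc hwc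
  rw [EventuallyEq, ae_restrict_iff' measurableSet_Ioi]
  filter_upwards [hae] with r hr h0
  have := hr h0
  rw [mul_eq_zero, or_iff_left (Real.rpow_pos_of_pos h0 α).ne'] at this
  linarith

end RadialPoly

/-! ### Regularity and asymptotics of weak solutions -/

theorem theorem1p1 (m : ℕ) (hm : 1 ≤ m) (α : ℝ) (hα : 0 < α - 2 * (m : ℝ) + 1)
    (u : ℝ → ℝ) (hu : IsWeakSolution m α u) :
    ContDiffOn ℝ ((2 * m : ℕ) : WithTop ℕ∞) u (Ioi 0) ∧
    (∀ r : ℝ, 0 < r → negLapPow α m u r = critNonlin m α u r) ∧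
    (∀ j : ℕ, j < m →
      Tendsto (fun r : ℝ => r ^ α * (lap α)^[j] u r) (𝓝[>] 0) (𝓝 0) ∧
      Tendsto (fun r : ℝ => r ^ α * deriv ((lap α)^[j] u) r) (𝓝[>] 0) (𝓝 0)) ∧
    (∀ j : ℕ, j ≤ m →
      DifferentiableOn ℝ ((lap α)^[j] u) (Ioi 0) ∧
      Tendsto ((lap α)^[j] u) atTop (𝓝 0) ∧
      Tendsto (deriv ((lap α)^[j] u)) atTop (𝓝 0)) ∧
    (∀ j : ℕ, j < m →
      (∀ t : ℝ, 0 < t →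
        IntegrableOn (fun s : ℝ => negLapPow α (j + 1) u s * s ^ α) (Ioc 0 t)) ∧
      ∀ r : ℝ, 0 < r →
        IntegrableOn
          (fun t : ℝ => t ^ (-α) * ∫ s in Ioc 0 t, negLapPow α (j + 1) u s * s ^ α) (Ioi r) ∧
        negLapPow α j u r =
          ∫ t in Ioi r, t ^ (-α) * ∫ s in Ioc 0 t, negLapPow α (j + 1) u s * s ^ α) := by
  have hm' : (1 : ℝ) ≤ m := by exact_mod_cast hm
  obtain ⟨hchain, -⟩ := hu.1.chain_spec hα hm
  have huc : ContinuousOn u (Ioi 0) := (hchain 0 (by omega)).1.continuousOn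
  have hub : PowBound (-(α - 2 * m + 1) / 2) u := (hchain 0 (by omega)).2.cast_exp (by simp)
  have hp := critExp_sub_two_pos hm hα
  have hfc := continuousOn_critNonlin hp huc
  have hfb := powBound_critNonlin hm hα hub
  have hrep := hu.eq_iterate_greenInt hm hα
  have hmid : (α + 2 * m + 1) / 2 < α + 1 := by linarith
  have hmid2 : 2 * (m : ℝ) < (α + 2 * m + 1) / 2 := by linarith
  set f := critNonlin m α u
  -- The iterated Laplacians of `u` are the lower iterates of the Green operator on `f`.
  have hlap : ∀ j ≤ m, EqOn (negLapPow α j u) ((greenInt α)^[m - j] f) (Ioi 0) := by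
    intro j hj r hr
    have hjm : (j : ℝ) ≤ m := by exact_mod_cast hj
    have hcast : ((m - j : ℕ) : ℝ) = m - j := Nat.cast_sub hj
    have h1 := iterate_greenInt (α := α) hfc hfb hmid (m - j) (by rw [hcast]; linarith)
    have h2 := (chain_iterate_greenInt (α := α) h1.1.continuousOn h1.2
      (by rw [hcast]; linarith) j (by rw [hcast]; linarith)).2.2 hr
    rw [← Function.iterate_add_apply, Nat.add_sub_cancel' hj] at h2
    rw [negLapPow, ← chain_two_mul, chain_congr α hrep _ hr, h2, ← mul_assoc, ← mul_pow]
    simp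
  obtain ⟨w1, w2, -⟩ := chain_iterate_greenInt (α := α) hfc hfb hmid m hmid2
  have hud : ∀ k < 2 * m, ContDiffOn ℝ 1 (chain α u k) (Ioi 0) := fun k hk =>
    (w2 k hk).congr (chain_congr α hrep k)
  have hupb : ∀ k ≤ 2 * m, PowBound (2 * m - k - (α + 2 * m + 1) / 2) (chain α u k) :=
    fun k hk => (w1 k hk).2.congr (chain_congr α hrep k)
  have htop : EqOn ((lap α)^[m] u) (fun r => (-1) ^ m * f r) (Ioi 0) := by
    intro r hr
    have := hlap m le_rfl hr
    rw [Nat.sub_self, Function.iterate_zero_apply, negLapPow] at this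
    simp only [← this, ← mul_assoc, ← mul_pow]
    simp
  have hderiv : ∀ j, deriv ((lap α)^[j] u) = chain α u (2 * j + 1) := fun j => by
    rw [chain_succ_of_even α u (even_two_mul j), chain_two_mul]
  refine ⟨(iterate_greenInt hfc hfb hmid m hmid2).1.congr hrep, fun r hr => ?_, fun j hj => ?_,
    fun j hj => ?_, fun j hj => ?_⟩
  · simpa using hlap m le_rfl hr
  · have hjm : (j : ℝ) + 1 ≤ m := by exact_mod_cast hj
    constructor
    · rw [← chain_two_mul]
      refine ((PowBound.rpow α).mul (hupb (2 * j) (by omega))).tendsto_zero ?_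
      push_cast
      linarith
    · rw [hderiv]
      refine ((PowBound.rpow α).mul (hupb (2 * j + 1) (by omega))).tendsto_zero ?_
      push_cast
      linarith
  · rcases hj.lt_or_eq with h | rfl
    · have hjm : (0 : ℝ) ≤ j := Nat.cast_nonneg j
      refine ⟨?_, ?_, ?_⟩
      · rw [← chain_two_mul]
        exact (hud _ (by omega)).differentiableOn (by simp)
      · rw [← chain_two_mul]
        refine (hupb (2 * j) (by omega)).tendsto_atTop ?_
        push_cast
        linarith
      · rw [hderiv]
        refine (hupb (2 * j + 1) (by omega)).tendsto_atTop ?_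
        push_cast
        linarith
    · have hfd : ∀ r : ℝ, 0 < r → HasDerivAt f
          ((critExp j α - 2 + 1) * |u r| ^ (critExp j α - 2) * deriv u r) r := fun r hr =>
        (hasDerivAt_abs_rpow_mul_self hp (u r)).comp r
          ((((hud 0 (by omega)).differentiableOn (by simp)).differentiableAt
            (Ioi_mem_nhds hr)).hasDerivAt)
      refine ⟨?_, ?_, ?_⟩
      · refine DifferentiableOn.congr (fun r hr => ?_) htop
        exact ((hfd r hr).differentiableAt.const_mul _).differentiableWithinAt
      · refine ((hfb.const_mul ((-1) ^ j)).tendsto_atTop (by linarith)).congr' ?_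
        filter_upwards [eventually_gt_atTop 0] with r hr using (htop hr).symm
      · have hu0 : Tendsto u atTop (𝓝 0) := hub.tendsto_atTop (by linarith)
        have hu1 : Tendsto (deriv u) atTop (𝓝 0) := by
          have h1 := hupb 1 (by omega)
          rw [chain_succ_of_even α u (k := 0) (by simp), chain_zero] at h1
          refine h1.tendsto_atTop ?_
          push_cast
          linarith
        have h2 : Tendsto (fun r => |u r| ^ (critExp j α - 2)) atTop (𝓝 0) := by
          have := (hu0.abs).rpow_const (p := critExp j α - 2) (Or.inr hp.le)
          rwa [abs_zero, Real.zero_rpow hp.ne'] at this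
        have h3 := ((h2.const_mul (critExp j α - 2 + 1)).mul hu1).const_mul ((-1 : ℝ) ^ j)
        simp only [mul_zero] at h3
        refine h3.congr' ?_
        filter_upwards [eventually_gt_atTop 0] with r hr
        rw [htop.deriv isOpen_Ioi hr, ((hfd r hr).const_mul _).deriv]
  · have hjm : (j : ℝ) + 1 ≤ m := by exact_mod_cast hj
    have hj0 : (0 : ℝ) ≤ j := Nat.cast_nonneg j
    have hcast : ((m - (j + 1) : ℕ) : ℝ) = m - (j + 1) := by
      rw [Nat.cast_sub hj]
      push_cast
      rfl
    have e := hlap (j + 1) hj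
    have h1 := iterate_greenInt (α := α) hfc hfb hmid (m - (j + 1)) (by rw [hcast]; linarith)
    rw [hcast] at h1
    have hc : ContinuousOn (negLapPow α (j + 1) u) (Ioi 0) := h1.1.continuousOn.congr e
    have hb := h1.2.congr e
    refine ⟨fun t _ => integrableOn_mul_rpow hc hb (by linarith) t, fun r hr =>
      ⟨integrableOn_flux hc hb (by linarith) (by linarith) hr, ?_⟩⟩
    rw [hlap j hj.le hr, show m - j = m - (j + 1) + 1 by omega, Function.iterate_succ_apply']
    exact (greenInt_congr e r).symm
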